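/- Let $n,m\ge 1$. All cubes have sides parallel to the axes, and $\langle f\rangle_E=\frac1{|E|}\int_E f$. A dyadic grid in $\mathbb{R}^d$ is a collection of half-open cubes $\prod_{i=1}^d[a_i,a_i+\ell)$ with side lengths $\ell\in\{2^k:k\in\mathbb{Z}\}$, such that for each $k$ the cubes of side length $2^k$ partition $\mathbb{R}^d$ and any two cubes of the collection are nested or disjoint. A bi-parameter $A_2$ weight is a locally integrable, a.e. positive function $w$ on $\mathbb{R}^n\times\mathbb{R}^m$ with $$[w]_{A_2}:=\sup_{R}\,\langle w\rangle_R\,\langle w^{-1}\rangle_R<\infty,$$ the supremum being over all $R=I\times J$ with $I\subset\mathbb{R}^n$, $J\subset\mathbb{R}^m$ cubes. Write $w(E)=\int_E w$. For an interval $L=[a,a+\ell)$ put $h_L^0=|L|^{-1/2}1_L$ and $h_L^1=|L|^{-1/2}(1_{[a,a+\ell/2)}-1_{[a+\ell/2,a+\ell)})$; for a cube $I=I_1\times\cdots\times I_d$ and $\eta\in\{0,1\}^d$ put $h_I^\eta=h_{I_1}^{\eta_1}\otimes\cdots\otimes h_{I_d}^{\eta_d}$. Given dyadic grids $\mathcal{D}^n$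 in $\mathbb{R}^n$ and $\mathcal{D}^m$ in $\mathbb{R}^m$, a bi-parameter $A_2$ weight $w$ and a locally integrable $b\colon\mathbb{R}^{n+m}\to\mathbb{C}$, define $$\|b\|_{\mathrm{bmo}_{\mathcal{D}^n,\mathcal{D}^m}(w)}:=\sup_{R\in\mathcal{D}^n\times\mathcal{D}^m}\frac1{w(R)}\int_R|b-\langle b\rangle_R|$$ and $$\|b\|_{\mathrm{BMO}_{\mathrm{prod}}^{\mathcal{D}^n,\mathcal{D}^m}(w)}:=\sup_{\Omega}\Big(\frac1{w(\Omega)}\sum_{\substack{I\in\mathcal{D}^n,\,J\in\mathcal{D}^m\\ I\times J\subset\Omega}}\ \sum_{\substack{\eta\in\{0,1\}^n\setminus\{0\}\\ \zeta\in\{0,1\}^m\setminus\{0\}}}\Big|\int b\,(h_I^\eta\otimes h_J^\zeta)\Big|^2\langle w\rangle_{I\times J}^{-1}\Big)^{1/2},$$ where the supremum is over all $\Omega\subset\mathbb{R}^{n+m}$ with $|\Omega|<\infty$ such that every $x\in\Omega$ lies in some $I\times J\subset\Omega$ with $I\in\mathcal{D}^n$, $J\in\mathcal{D}^m$ (sets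 with $\Omega=\emptyset$ or $w(\Omega)=\infty$ contribute $0$). Both quantities take values in $[0,\infty]$. Then there is a nondecreasing function $C\colon[0,\infty)\to[0,\infty)$, depending only on $n$ and $m$, such that for all dyadic grids $\mathcal{D}^n,\mathcal{D}^m$, all bi-parameter $A_2$ weights $w$ on $\mathbb{R}^n\times\mathbb{R}^m$ and all locally integrable $b\colon\mathbb{R}^{n+m}\to\mathbb{C}$, $$\|b\|_{\mathrm{BMO}_{\mathrm{prod}}^{\mathcal{D}^n,\mathcal{D}^m}(w)}\le C([w]_{A_2})\,\|b\|_{\mathrm{bmo}_{\mathcal{D}^n,\mathcal{D}^m}(w)}.$$ -/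

import Mathlib

open MeasureTheory Set
open scoped ENNReal NNReal

noncomputable section

namespace Biparam

/-- A (half-open, axis-parallel) cube in `ℝⁿ`, given by its lower corner and side length. -/
structure Cube (n : ℕ) where
  corner : Fin n → ℝ
  side : ℝ
  side_pos : 0 < side

/-- The point set `∏ᵢ [cᵢ, cᵢ + ℓ)` of a cube. -/
def Cube.toSet {n : ℕ} (Q : Cube n) : Set (Fin n → ℝ) :=
  Set.pi univ fun i => Ico (Q.corner i) (Q.corner i + Q.side)

/-- The rectangle `I × J` in `ℝⁿ × ℝᵐ`. -/
def rect {n m : ℕ} (I : Cube n) (J : Cube m) : Set ((Fin n → ℝ) × (Fin m → ℝ)) :=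
  I.toSet ×ˢ J.toSet

/-- A dyadic grid in `ℝⁿ`: side lengths are integer powers of two, the cubes of each fixed side
length `2 ^ k` form a partition of `ℝⁿ`, and any two cubes are nested or disjoint. -/
structure IsDyadicGrid {n : ℕ} (D : Set (Cube n)) : Prop where
  side_eq : ∀ Q ∈ D, ∃ k : ℤ, Q.side = (2 : ℝ) ^ k
  partition : ∀ (k : ℤ) (x : Fin n → ℝ), ∃! Q : Cube n,
    Q ∈ D ∧ Q.side = (2 : ℝ) ^ k ∧ x ∈ Q.toSet
  nested : ∀ Q ∈ D, ∀ Q' ∈ D,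
    Q.toSet ⊆ Q'.toSet ∨ Q'.toSet ⊆ Q.toSet ∨ Disjoint Q.toSet Q'.toSet

/-- The one-dimensional `L²`-normalised Haar functions of the interval `[a, a + ℓ)`:
`false` gives the non-cancellative function `ℓ^{-1/2} 1_{[a, a + ℓ)}`, and `true` the cancellative
one, which is `ℓ^{-1/2}` on the left half and `-ℓ^{-1/2}` on the right half. -/
def haarOne (a l : ℝ) : Bool → ℝ → ℝ
  | false, t => (Real.sqrt l)⁻¹ * (Ico a (a + l)).indicator 1 t
  | true, t => (Real.sqrt l)⁻¹ *
      ((Ico a (a + l / 2)).indicator 1 t - (Ico (a + l / 2) (a + l)).indicator 1 t)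

/-- The Haar function `h_I^η = ⊗ᵢ h_{Iᵢ}^{ηᵢ}`. -/
def haar {n : ℕ} (I : Cube n) (η : Fin n → Bool) (x : Fin n → ℝ) : ℝ :=
  ∏ i, haarOne (I.corner i) I.side (η i) (x i)

/-- The signatures `η ∈ {0,1}ⁿ \ {0}` of the cancellative Haar functions. -/
def cancellative (n : ℕ) : Finset (Fin n → Bool) :=
  Finset.univ.filter fun η => η ≠ fun _ => false

/-- The pairing `⟨b, h_I^η ⊗ h_J^ζ⟩`. -/
def haarCoeff {n m : ℕ} (b : (Fin n → ℝ) × (Fin m → ℝ) → ℂ) (I : Cube n) (J : Cube m)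
    (η : Fin n → Bool) (ζ : Fin m → Bool) : ℂ :=
  ∫ x, b x * ((haar I η x.1 * haar J ζ x.2 : ℝ) : ℂ)

/-- `w(S) = ∫_S w` for a (nonnegative) weight `w`. -/
def weightOf {n m : ℕ} (w : (Fin n → ℝ) × (Fin m → ℝ) → ℝ)
    (S : Set ((Fin n → ℝ) × (Fin m → ℝ))) : ℝ≥0∞ :=
  ∫⁻ x in S, ENNReal.ofReal (w x)

/-- The average `⟨w⟩_{I × J}` of a (nonnegative) weight `w`. -/
def weightAvg {n m : ℕ} (w : (Fin n → ℝ) × (Fin m → ℝ) → ℝ) (I : Cube n) (J : Cube m) : ℝ≥0∞ :=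
  weightOf w (rect I J) / volume (rect I J)

/-- The bi-parameter `A₂` characteristic `sup_R ⟨w⟩_R ⟨w⁻¹⟩_R`, over all rectangles `R = I × J`
with `I ⊂ ℝⁿ`, `J ⊂ ℝᵐ` arbitrary cubes. -/
def A2Const {n m : ℕ} (w : (Fin n → ℝ) × (Fin m → ℝ) → ℝ) : ℝ≥0∞ :=
  ⨆ (I : Cube n) (J : Cube m), weightAvg w I J * weightAvg (fun x => (w x)⁻¹) I J

/-- `w` is a bi-parameter `A₂` weight: locally integrable, a.e. positive, `[w]_{A₂} < ∞`. -/
structure IsA2Weight {n m : ℕ} (w : (Fin n → ℝ) × (Fin m → ℝ) → ℝ) : Prop where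
  locallyIntegrable : LocallyIntegrable w volume
  ae_pos : ∀ᵐ x, 0 < w x
  const_lt_top : A2Const w < ∞

/-- The weighted dyadic little BMO norm
`sup_{R ∈ 𝒟ⁿ × 𝒟ᵐ} w(R)⁻¹ ∫_R |b - ⟨b⟩_R|`. -/
def littleBMO {n m : ℕ} (D : Set (Cube n)) (D' : Set (Cube m))
    (w : (Fin n → ℝ) × (Fin m → ℝ) → ℝ) (b : (Fin n → ℝ) × (Fin m → ℝ) → ℂ) : ℝ≥0∞ :=
  ⨆ (I ∈ D) (J ∈ D'),
    (∫⁻ x in rect I J, ‖b x - ⨍ y in rect I J, b y‖ₑ) / weightOf w (rect I J)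

/-- The sets `Ω` of finite Lebesgue measure such that every `x ∈ Ω` lies in some dyadic rectangle
`I × J ⊂ Ω`. -/
def Admissible {n m : ℕ} (D : Set (Cube n)) (D' : Set (Cube m))
    (Ω : Set ((Fin n → ℝ) × (Fin m → ℝ))) : Prop :=
  volume Ω < ∞ ∧ ∀ x ∈ Ω, ∃ I ∈ D, ∃ J ∈ D', x ∈ rect I J ∧ rect I J ⊆ Ω

/-- The weighted dyadic product BMO norm
`sup_Ω (w(Ω)⁻¹ ∑_{I × J ⊂ Ω} |⟨b, h_I ⊗ h_J⟩|² ⟨w⟩_{I × J}⁻¹)^{1/2}`, where each term includes the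
sum over all pairs of cancellative Haar functions on `I` and `J`.
Sets with `w(Ω) = 0` (only the empty set) or `w(Ω) = ∞` contribute `0`. -/
def prodBMO {n m : ℕ} (D : Set (Cube n)) (D' : Set (Cube m))
    (w : (Fin n → ℝ) × (Fin m → ℝ) → ℝ) (b : (Fin n → ℝ) × (Fin m → ℝ) → ℂ) : ℝ≥0∞ :=
  ⨆ (Ω : Set ((Fin n → ℝ) × (Fin m → ℝ))) (_ : Admissible D D' Ω),
    ((∑' R : {R : Cube n × Cube m // R.1 ∈ D ∧ R.2 ∈ D' ∧ rect R.1 R.2 ⊆ Ω},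
        (∑ η ∈ cancellative n, ∑ ζ ∈ cancellative m, ‖haarCoeff b R.1.1 R.1.2 η ζ‖ₑ ^ 2) /
          weightAvg w R.1.1 R.1.2) / weightOf w Ω) ^ (1 / 2 : ℝ)

end Biparam

end

/-! Freezing one factor of a rectangle turns `w` into a one-parameter dyadic A₂ weight: for fixed
`J` the averages of `w` and of `w⁻¹` over `I × J` are martingales in `I` whose product lies between
1 and Q = [w]_{A₂}, and the same holds with the roles exchanged. The product estimate is a
composition of two one-parameter estimates, applied to a finite family of rectangles inside Ω with
all sides larger than some 2^k.

For fixed `J`, the Haar coefficients are controlled by the martingale differences in `I` of the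
pairing of `b` with |I|⁻¹ 1_I ⊗ h_J. The weighted square function bound `treeSum_sq_le_leafSum`
replaces the sum over `I` by one over cubes `P` of side 2^k inside the maximal `I`. For fixed `P`,
what is left is a weighted sum over `J` of martingale differences of the averages of `b` on `P × J`.
Little BMO says that these averages come from a function of bounded weighted oscillation in the
second variable, so the Carleson packing estimate `treeSum_osc_le` bounds the sum by that of w(P ×
J) over maximal `J`. All `P` have the same size, so these rectangles are disjoint; they lie in Ω,
and their total weight is at most w(Ω).

The square function bound comes from a potential, quadratic in the martingale, whose increments
dominate the differences; the variation of the weight is paid for by the supermartingale `bellman`.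
The packing bound is a stopping-time argument: before stopping, the oscillation and the weight are
comparable to their values at the root, and ordinary orthogonality applies; the stopped cubes carry
at most the fraction 1 - 1/(8Q) of the weight, so the bound can be iterated. Another potential
encodes the stopping time. -/

namespace Biparam

/-! ### Telescoping sums over finite trees -/

section Tree

variable {α ι : Type*} [Fintype ι]

/-- The sum of `d` over all descendants of `K` of generation less than `N`. -/
def treeSum (child : α → ι → α) (d : α → ℝ) : ℕ → α → ℝ
  | 0, _ => 0
  | N + 1, K => d K + ∑ i, treeSum child d N (child K i)

/-- The sum of `g` over all descendants of `K` of generation exactly `N`. -/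
def leafSum (child : α → ι → α) (g : α → ℝ) : ℕ → α → ℝ
  | 0, K => g K
  | N + 1, K => ∑ i, leafSum child g N (child K i)

theorem leafSum_mono {child : α → ι → α} {g g' : α → ℝ} (h : ∀ K, g K ≤ g' K) (N : ℕ) (K : α) :
    leafSum child g N K ≤ leafSum child g' N K := by
  induction N generalizing K with
  | zero => exact h K
  | succ N ih => exact Finset.sum_le_sum fun i _ => ih _

theorem leafSum_const_mul {child : α → ι → α} (c : ℝ) (g : α → ℝ) (N : ℕ) (K : α) :
    leafSum child (fun K => c * g K) N K = c * leafSum child g N K := by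
  induction N generalizing K with
  | zero => rfl
  | succ N ih => simp only [leafSum, ih, Finset.mul_sum]

/-- A potential that grows by at least `d` at each splitting telescopes down the tree. -/
theorem treeSum_add_le_leafSum {child : α → ι → α} {d g : α → ℝ}
    (h : ∀ K, d K + g K ≤ ∑ i, g (child K i)) (N : ℕ) (K : α) :
    treeSum child d N K + g K ≤ leafSum child g N K := by
  induction N generalizing K with
  | zero => simp [treeSum, leafSum]
  | succ N ih =>
    have := Finset.sum_le_sum fun i (_ : i ∈ Finset.univ) => ih (child K i)
    rw [Finset.sum_add_distrib] at this
    simp only [treeSum, leafSum]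
    linarith [h K]

end Tree

/-! ### The Bellman function of an A₂ weight and one step of the square function -/

section Step

variable {ι : Type*} [Fintype ι] {E : Type*} [NormedAddCommGroup E]

/-- The Bellman function `a u - 2 Q² / s - u² s`, `a = 1 + Q + 2 Q²`, of a dyadic `A₂` weight. -/
noncomputable def bellman (Q u s : ℝ) : ℝ := (1 + Q + 2 * Q ^ 2) * u - 2 * Q ^ 2 / s - u ^ 2 * s

/-- The linear coefficient is chosen for this: on 1 ≤ us ≤ Q the two subtracted terms are at most
2Q²u and Qu, which leaves u. -/
theorem le_bellman {Q u s : ℝ} (hu : 0 < u) (hs : 0 < s) (h1 : 1 ≤ u * s) (hQ : u * s ≤ Q) :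
    u ≤ bellman Q u s := by
  have h : 1 / s ≤ u := by rw [div_le_iff₀ hs]; exact h1
  have h2 : 2 * Q ^ 2 / s ≤ 2 * Q ^ 2 * u := by
    rw [div_eq_mul_one_div]; gcongr
  have h3 : u ^ 2 * s ≤ Q * u := by nlinarith
  unfold bellman; nlinarith

theorem bellman_le {Q u s : ℝ} (hs : 0 < s) :
    bellman Q u s ≤ (1 + Q + 2 * Q ^ 2) * u := by
  have : 0 ≤ 2 * Q ^ 2 / s := by positivity
  have : 0 ≤ u ^ 2 * s := by positivity
  unfold bellman; linarith

/-- A quantitative concavity: the bracket is the tangent plane at (u, s). The term -u²s alone has an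
indefinite cross term in the increments; the concave term -2Q²/s is large enough to complete the
square, since us ≤ Q. -/
theorem bellman_step {Q u s u' s' : ℝ} (hu : 0 < u) (hs : 0 < s) (hs' : 0 < s')
    (hQ : u * s ≤ Q) :
    bellman Q u' s' + s' * (u' - u) ^ 2 / 2 ≤ bellman Q u s +
      ((1 + Q + 2 * Q ^ 2 - 2 * u * s) * (u' - u) + (2 * Q ^ 2 / s ^ 2 - u ^ 2) * (s' - s)) := by
  have key : 2 * u * (u' - u) * (s' - s) + s' * (u' - u) ^ 2 / 2 + 2 * Q ^ 2 * (s' - s) ^ 2 / (s ^ 2 * s')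
      ≥ 0 := by
    have h1 : 2 * u ^ 2 * (s' - s) ^ 2 / s' ≤ 2 * Q ^ 2 * (s' - s) ^ 2 / (s ^ 2 * s') := by
      rw [div_le_div_iff₀ hs' (by positivity)]
      have : (u * s) ^ 2 ≤ Q ^ 2 := by gcongr
      have h0 : 0 ≤ 2 * (s' - s) ^ 2 * s' := by positivity
      nlinarith [mul_le_mul_of_nonneg_left this h0]
    have h2 : 2 * u * (u' - u) * (s' - s) + s' * (u' - u) ^ 2 / 2 + 2 * u ^ 2 * (s' - s) ^ 2 / s'
        = (s' * (u' - u) + 2 * u * (s' - s)) ^ 2 / (2 * s') := by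
      field_simp; ring
    have h3 : 0 ≤ (s' * (u' - u) + 2 * u * (s' - s)) ^ 2 / (2 * s') := by positivity
    linarith
  have e : bellman Q u s + ((1 + Q + 2 * Q ^ 2 - 2 * u * s) * (u' - u) +
      (2 * Q ^ 2 / s ^ 2 - u ^ 2) * (s' - s)) - bellman Q u' s' - s' * (u' - u) ^ 2 / 2 =
      2 * u * (u' - u) * (s' - s) + s' * (u' - u) ^ 2 / 2 +
        2 * Q ^ 2 * (s' - s) ^ 2 / (s ^ 2 * s') := by
    unfold bellman; field_simp; ring
  linarith

/-- The tangent terms cancel on averaging over the children, so only the quadratic gain survives. -/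
theorem bellman_avg {Q u s : ℝ} {u' s' : ι → ℝ} (hu : 0 < u) (hs : 0 < s) (hs' : ∀ i, 0 < s' i)
    (hQ : u * s ≤ Q) (hum : ∑ i, u' i = Fintype.card ι * u)
    (hsm : ∑ i, s' i = Fintype.card ι * s) :
    ∑ i, bellman Q (u' i) (s' i) + ∑ i, s' i * (u' i - u) ^ 2 / 2 ≤
      Fintype.card ι * bellman Q u s := by
  have := Finset.sum_le_sum fun i (_ : i ∈ Finset.univ) =>
    bellman_step (u' := u' i) hu hs (hs' i) hQ
  simp only [Finset.sum_add_distrib, ← Finset.mul_sum, Finset.sum_sub_distrib, hum, hsm,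
    Finset.sum_const, Finset.card_univ, nsmul_eq_mul] at this
  linarith

/-- The potential whose increments dominate the weighted square function. -/
noncomputable def potential (Q u s : ℝ) (x : E) : ℝ :=
  2 * (‖x‖ ^ 2 / u) + 4 * (1 + Q + 2 * Q ^ 2) ^ 2 * (‖x‖ ^ 2 / bellman Q u s)

theorem potential_nonneg {Q u s : ℝ} (hu : 0 < u) (hs : 0 < s) (h1 : 1 ≤ u * s) (hQ : u * s ≤ Q)
    (x : E) : 0 ≤ potential Q u s x := by
  have := hu.trans_le (le_bellman hu hs h1 hQ)
  unfold potential; positivity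

theorem potential_le {Q u s : ℝ} (hu : 0 < u) (hs : 0 < s) (h1 : 1 ≤ u * s) (hQ : u * s ≤ Q)
    (x : E) : potential Q u s x ≤ (2 + 4 * (1 + Q + 2 * Q ^ 2) ^ 2) * (‖x‖ ^ 2 / u) := by
  have : ‖x‖ ^ 2 / bellman Q u s ≤ ‖x‖ ^ 2 / u := by
    gcongr; exact le_bellman hu hs h1 hQ
  have := mul_le_mul_of_nonneg_left this (by positivity : 0 ≤ 4 * (1 + Q + 2 * Q ^ 2) ^ 2)
  unfold potential; linarith

variable [InnerProductSpace ℝ E]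

theorem sq_norm_div_eq {w : ℝ} (hw : 0 < w) (x g : E) :
    ‖x‖ ^ 2 / w = 2 * inner ℝ x g - ‖g‖ ^ 2 * w + ‖x - w • g‖ ^ 2 / w := by
  rw [norm_sub_sq_real, norm_smul, inner_smul_right, Real.norm_of_nonneg hw.le]
  field_simp; ring

/-- The convexity of ‖x‖²/w with its exact remainder. The weights `w i` need not average to `W`: a
deficit gives the middle term, which is the gain when `w` is a supermartingale. -/
theorem sum_sq_norm_div {w : ι → ℝ} (hw : ∀ i, 0 < w i) {f : ι → E} {x : E}
    (hf : ∑ i, f i = (Fintype.card ι : ℝ) • x) {W : ℝ} (hW : 0 < W) :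
    ∑ i, ‖f i‖ ^ 2 / w i = Fintype.card ι * (‖x‖ ^ 2 / W) +
      (‖x‖ / W) ^ 2 * (Fintype.card ι * W - ∑ i, w i) +
      ∑ i, ‖f i - w i • (W⁻¹ • x)‖ ^ 2 / w i := by
  simp_rw [fun i => sq_norm_div_eq (hw i) (f i) (W⁻¹ • x)]
  rw [Finset.sum_add_distrib, Finset.sum_sub_distrib, ← Finset.mul_sum, ← Finset.mul_sum,
    ← sum_inner, hf, inner_smul_left, inner_smul_right, real_inner_self_eq_norm_sq, norm_smul,
    Real.norm_of_nonneg (by positivity)]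
  simp only [conj_trivial]
  field_simp; ring

/-- A difference splits into f i - (u' i / u) x and a multiple of x caused by the change of weight.
The increment of ‖x‖²/u is the energy of the first part. For the second, 1/u' ≤ s' brings in the
Bellman gain, and this gain is contained in the increment of ‖x‖²/`bellman`. -/
theorem potential_step {Q u s : ℝ} {u' s' : ι → ℝ} (hu : 0 < u) (hs : 0 < s)
    (hu' : ∀ i, 0 < u' i) (hs' : ∀ i, 0 < s' i) (h1 : 1 ≤ u * s) (hQ : u * s ≤ Q)
    (h1' : ∀ i, 1 ≤ u' i * s' i) (hQ' : ∀ i, u' i * s' i ≤ Q)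
    (hum : ∑ i, u' i = Fintype.card ι * u) (hsm : ∑ i, s' i = Fintype.card ι * s)
    {f : ι → E} {x : E} (hf : ∑ i, f i = (Fintype.card ι : ℝ) • x) :
    ∑ i, ‖f i - x‖ ^ 2 / u' i + Fintype.card ι * potential Q u s x ≤
      ∑ i, potential Q (u' i) (s' i) (f i) := by
  set q := (Fintype.card ι : ℝ)
  set a := 1 + Q + 2 * Q ^ 2 with ha
  have hQ0 : 0 < Q := by linarith
  have ha0 : 0 < a := by positivity
  have hW : u ≤ bellman Q u s := le_bellman hu hs h1 hQ
  have hW0 := hu.trans_le hW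
  have hW' : ∀ i, 0 < bellman Q (u' i) (s' i) :=
    fun i => (hu' i).trans_le (le_bellman (hu' i) (hs' i) (h1' i) (hQ' i))
  have e1 := sum_sq_norm_div hu' hf hu
  have e2 := sum_sq_norm_div hW' hf hW0
  have e3 : 0 ≤ ∑ i, ‖f i - bellman Q (u' i) (s' i) • ((bellman Q u s)⁻¹ • x)‖ ^ 2 /
      bellman Q (u' i) (s' i) :=
    Finset.sum_nonneg fun i _ => div_nonneg (sq_nonneg _) (hW' i).le
  have e4 := bellman_avg hu hs hs' hQ hum hsm
  have e5 : ∑ i, (u' i - u) ^ 2 / u' i ≤ 2 * ∑ i, s' i * (u' i - u) ^ 2 / 2 := by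
    rw [Finset.mul_sum]
    refine Finset.sum_le_sum fun i _ => ?_
    rw [div_le_iff₀ (hu' i)]
    nlinarith [mul_le_mul_of_nonneg_right (h1' i) (sq_nonneg (u' i - u))]
  have e6 : ∑ i, ‖f i - x‖ ^ 2 / u' i ≤ 2 * ∑ i, ‖f i - u' i • (u⁻¹ • x)‖ ^ 2 / u' i +
      2 * ((‖x‖ / u) ^ 2 * ∑ i, (u' i - u) ^ 2 / u' i) := by
    simp only [Finset.mul_sum, ← Finset.sum_add_distrib]
    refine Finset.sum_le_sum fun i _ => ?_
    have hd : f i - x = (f i - u' i • (u⁻¹ • x)) + ((u' i - u) / u) • x := by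
      rw [smul_smul, sub_div, div_self hu.ne', sub_smul, one_smul, div_eq_mul_inv]; abel
    have hn : ‖f i - x‖ ^ 2 ≤ 2 * ‖f i - u' i • (u⁻¹ • x)‖ ^ 2 + 2 * ‖((u' i - u) / u) • x‖ ^ 2 := by
      rw [hd]
      have := norm_add_le (f i - u' i • (u⁻¹ • x)) (((u' i - u) / u) • x)
      nlinarith [norm_nonneg ((f i - u' i • (u⁻¹ • x)) + ((u' i - u) / u) • x),
        sq_nonneg (‖f i - u' i • (u⁻¹ • x)‖ - ‖((u' i - u) / u) • x‖)]
    have hn2 : ‖((u' i - u) / u) • x‖ ^ 2 = (‖x‖ / u) ^ 2 * (u' i - u) ^ 2 := by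
      rw [norm_smul, mul_pow, Real.norm_eq_abs, sq_abs]; ring
    rw [hn2] at hn
    calc ‖f i - x‖ ^ 2 / u' i ≤ (2 * ‖f i - u' i • (u⁻¹ • x)‖ ^ 2 +
          2 * ((‖x‖ / u) ^ 2 * (u' i - u) ^ 2)) / u' i := by have := (hu' i).le; gcongr
      _ = _ := by ring
  -- The upper bound `bellman` ≤ a u costs the factor a² here, which is why `potential` carries 4a².
  have e7 : (‖x‖ / u) ^ 2 ≤ a ^ 2 * (‖x‖ / bellman Q u s) ^ 2 := by
    rw [← mul_pow]
    gcongr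
    rw [div_le_iff₀ hu, mul_comm a, div_mul_eq_mul_div, div_mul_eq_mul_div, le_div_iff₀ hW0]
    have : bellman Q u s ≤ a * u := bellman_le hs
    nlinarith [norm_nonneg x]
  have e8 : (‖x‖ / u) ^ 2 * ∑ i, (u' i - u) ^ 2 / u' i ≤
      2 * a ^ 2 * ((‖x‖ / bellman Q u s) ^ 2 *
        (q * bellman Q u s - ∑ i, bellman Q (u' i) (s' i))) := by
    calc _ ≤ (a ^ 2 * (‖x‖ / bellman Q u s) ^ 2) *
          (2 * (q * bellman Q u s - ∑ i, bellman Q (u' i) (s' i))) := by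
            apply mul_le_mul e7 (by linarith) _ (by positivity)
            exact Finset.sum_nonneg fun i _ => div_nonneg (sq_nonneg _) (hu' i).le
      _ = _ := by ring
  have e9 : 4 * a ^ 2 * ((‖x‖ / bellman Q u s) ^ 2 *
        (q * bellman Q u s - ∑ i, bellman Q (u' i) (s' i))) ≤
      4 * a ^ 2 * (∑ i, ‖f i‖ ^ 2 / bellman Q (u' i) (s' i) - q * (‖x‖ ^ 2 / bellman Q u s)) := by
    apply mul_le_mul_of_nonneg_left _ (by positivity); linarith
  rw [hum, sub_self, mul_zero, add_zero] at e1
  simp only [potential, Finset.sum_add_distrib, ← Finset.mul_sum]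
  rw [← ha]
  linarith

end Step

/-! ### The square function and packing estimates on a tree -/

section Tree

variable {α ι : Type*} [Fintype ι] {E : Type*} [NormedAddCommGroup E] [InnerProductSpace ℝ E]

/-- The martingale square function is bounded on `L²(1/u)` for a dyadic `A₂` weight `u`
with dual weight `s`. -/
theorem treeSum_sq_le_leafSum {child : α → ι → α} {V u s : α → ℝ} {f : α → E} {Q : ℝ}
    (hV : ∀ K, 0 < V K) (hVc : ∀ K i, Fintype.card ι * V (child K i) = V K)
    (hu : ∀ K, 0 < u K) (hs : ∀ K, 0 < s K) (h1 : ∀ K, 1 ≤ u K * s K) (hQ : ∀ K, u K * s K ≤ Q)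
    (hum : ∀ K, ∑ i, u (child K i) = Fintype.card ι * u K)
    (hsm : ∀ K, ∑ i, s (child K i) = Fintype.card ι * s K)
    (hf : ∀ K, ∑ i, f (child K i) = (Fintype.card ι : ℝ) • f K) (N : ℕ) (K : α) :
    treeSum child (fun K => V K * (∑ i, ‖f (child K i) - f K‖ ^ 2) / u K) N K ≤
      Fintype.card ι ^ 2 * (2 + 4 * (1 + Q + 2 * Q ^ 2) ^ 2) *
        leafSum child (fun K => V K * (‖f K‖ ^ 2 / u K)) N K := by
  set q := (Fintype.card ι : ℝ) with hq
  have hd : ∀ K, V K * (∑ i, ‖f (child K i) - f K‖ ^ 2) / u K +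
      q ^ 2 * (V K * potential Q (u K) (s K) (f K)) ≤
      ∑ i, q ^ 2 * (V (child K i) *
        potential Q (u (child K i)) (s (child K i)) (f (child K i))) := by
    intro K
    have h := potential_step (hu K) (hs K) (fun i => hu (child K i)) (fun i => hs (child K i))
      (h1 K) (hQ K) (fun i => h1 _) (fun i => hQ _) (hum K) (hsm K) (hf K)
    -- One factor of `q` passes from the parent's weight to the child's, by positivity of the
    -- siblings; the other in `q ^ 2` comes from V (child K i) = V K / q.
    have hle : (∑ i, ‖f (child K i) - f K‖ ^ 2) / u K ≤
        q * ∑ i, ‖f (child K i) - f K‖ ^ 2 / u (child K i) := by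
      rw [Finset.sum_div, Finset.mul_sum]
      refine Finset.sum_le_sum fun i _ => ?_
      have : u (child K i) ≤ q * u K := by
        rw [← hum K]
        exact Finset.single_le_sum (f := fun i => u (child K i)) (fun j _ => (hu _).le)
          (Finset.mem_univ i)
      rw [← mul_div_assoc, div_le_div_iff₀ (hu _) (hu _)]
      nlinarith [sq_nonneg ‖f (child K i) - f K‖]
    have e : ∑ i, q ^ 2 * (V (child K i) *
        potential Q (u (child K i)) (s (child K i)) (f (child K i))) =
        q * V K * ∑ i, potential Q (u (child K i)) (s (child K i)) (f (child K i)) := by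
      rw [Finset.mul_sum]
      refine Finset.sum_congr rfl fun i _ => ?_
      rw [← hVc K i]; ring
    rw [e]
    have hqV : 0 ≤ q * V K := mul_nonneg (Nat.cast_nonneg _) (hV K).le
    have h2 := mul_le_mul_of_nonneg_left h hqV
    have h3 := mul_le_mul_of_nonneg_left hle (hV K).le
    rw [mul_div_assoc]
    linarith
  have t := treeSum_add_le_leafSum hd N K
  rw [leafSum_const_mul] at t
  have m : leafSum child (fun K => V K * potential Q (u K) (s K) (f K)) N K ≤
      leafSum child (fun K => (2 + 4 * (1 + Q + 2 * Q ^ 2) ^ 2) * (V K * (‖f K‖ ^ 2 / u K))) N K := by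
    refine leafSum_mono (fun K => ?_) N K
    have := mul_le_mul_of_nonneg_left (potential_le (hu K) (hs K) (h1 K) (hQ K) (f K)) (hV K).le
    linarith
  rw [leafSum_const_mul] at m
  have p : 0 ≤ q ^ 2 * (V K * potential Q (u K) (s K) (f K)) :=
    mul_nonneg (sq_nonneg _) (mul_nonneg (hV K).le
      (potential_nonneg (hu K) (hs K) (h1 K) (hQ K) _))
  have := mul_le_mul_of_nonneg_left m (sq_nonneg q)
  linarith

theorem sum_sq_norm_sub {f : ι → E} {x : E} (hf : ∑ i, f i = (Fintype.card ι : ℝ) • x) (c : E) :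
    ∑ i, ‖f i - x‖ ^ 2 = ∑ i, ‖f i - c‖ ^ 2 - Fintype.card ι * ‖x - c‖ ^ 2 := by
  have e : ∀ i, ‖f i - x‖ ^ 2 = ‖f i - c‖ ^ 2 - 2 * inner ℝ (f i - c) (x - c) + ‖x - c‖ ^ 2 := by
    intro i
    rw [← norm_sub_sq_real]; congr 2; abel
  simp_rw [e, Finset.sum_add_distrib, Finset.sum_sub_distrib, ← Finset.mul_sum, ← sum_inner,
    Finset.sum_sub_distrib, hf]
  simp only [Finset.sum_const, Finset.card_univ, ← Nat.cast_smul_eq_nsmul ℝ,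
    ← smul_sub, inner_smul_left, real_inner_self_eq_norm_sq, conj_trivial]
  ring

/-- The Carleson packing estimate for a function of weighted bounded mean oscillation. -/
theorem treeSum_osc_le {child : α → ι → α} {p : α → Prop} (hp : ∀ K, p K → ∀ i, p (child K i))
    {V u s : α → ℝ} {β : α → E} {a : α → α → ℝ} {Q ν : ℝ} (hν : 0 < ν)
    (hq : 0 < Fintype.card ι)
    (hV : ∀ K, 0 < V K) (hVc : ∀ K i, Fintype.card ι * V (child K i) = V K)
    (hu : ∀ K, 0 < u K) (hs : ∀ K, 0 < s K) (h1 : ∀ K, 1 ≤ u K * s K) (hQ : ∀ K, u K * s K ≤ Q)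
    (hum : ∀ K, ∑ i, u (child K i) = Fintype.card ι * u K)
    (hsm : ∀ K, ∑ i, s (child K i) = Fintype.card ι * s K)
    (ham : ∀ K I, ∑ i, a K (child I i) = Fintype.card ι * a K I)
    (hβm : ∀ K, ∑ i, β (child K i) = (Fintype.card ι : ℝ) • β K)
    (hβa : ∀ K I, ‖β I - β K‖ ≤ a K I) (ha : ∀ K, p K → a K K ≤ ν * u K)
    (N : ℕ) (K : α) (hK : p K) :
    treeSum child (fun K => V K * (∑ i, ‖β (child K i) - β K‖ ^ 2) / u K) N K ≤
      128 * Q ^ 2 * Fintype.card ι ^ 2 * ν ^ 2 * (V K * u K) := by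
  set q := (Fintype.card ι : ℝ) with hqdef
  have hq0 : 0 < q := Nat.cast_pos.2 hq
  have hQ1 : 1 ≤ Q := (h1 K).trans (hQ K)
  have hQ0 : 0 < Q := by linarith
  -- Strong induction restarts the estimate at stopped cubes, which have fewer generations below
  -- them.
  induction N using Nat.strong_induction_on generalizing K with
  | _ N ihN =>
  set d : α → ℝ := fun K => V K * (∑ i, ‖β (child K i) - β K‖ ^ 2) / u K with hd
  -- Fixed by requiring C y/(8Q), the weight lost by stopping, to equal the energy 16 Q q² ν² y
  -- spent before stopping; see `h6`.
  set C : ℝ := 128 * Q ^ 2 * q ^ 2 * ν ^ 2 with hC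
  have hC0 : 0 < C := by positivity
  set y := u K with hy
  have hy0 : 0 < y := hu K
  -- the potential attached to `K`
  set G : α → ℝ := fun I => V I * (8 * Q * q / y * (2 * q * ν * y * a K I - ‖β I - β K‖ ^ 2) +
    C * (u I - y / Q * (1 - a K I / (2 * ν * y)) + s I * (y ^ 2 / (4 * Q ^ 2)) + y / (8 * Q)))
    with hG
  have ha0 : ∀ I, 0 ≤ a K I := fun I => (norm_nonneg _).trans (hβa K I)
  have hfirst : ∀ I, a K I ≤ 2 * q * ν * y → ‖β I - β K‖ ^ 2 ≤ 2 * q * ν * y * a K I := by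
    intro I hI
    have := hβa K I
    nlinarith [norm_nonneg (β I - β K), ha0 I]
  -- The arithmetic-geometric mean inequality with us ≥ 1: where `u` is small, the dual weight must
  -- be large.
  have hcs : ∀ I, y / Q ≤ u I + s I * (y ^ 2 / (4 * Q ^ 2)) := by
    intro I
    have e : u I * (u I + s I * (y ^ 2 / (4 * Q ^ 2)) - y / Q) =
      (u I - y / (2 * Q)) ^ 2 + (u I * s I - 1) * (y ^ 2 / (4 * Q ^ 2)) := by
      field_simp; ring
    have h0 : 0 ≤ (u I - y / (2 * Q)) ^ 2 + (u I * s I - 1) * (y ^ 2 / (4 * Q ^ 2)) := by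
      have := sub_nonneg.2 (h1 I); positivity
    rw [← e] at h0
    have := nonneg_of_mul_nonneg_right h0 (hu I)
    linarith
  have hy8 : 0 ≤ y / (8 * Q) := by positivity
  have hyQ : 0 ≤ y / Q := by positivity
  have hs4 : ∀ I, 0 ≤ s I * (y ^ 2 / (4 * Q ^ 2)) := fun I => by have := (hs I).le; positivity
  have har : ∀ I, 0 ≤ a K I / (2 * ν * y) := fun I => by have := ha0 I; positivity
  have hG1 : ∀ I, a K I ≤ 2 * q * ν * y → 0 ≤ G I := by
    intro I hI
    have := hfirst I hI
    have h2 : 0 ≤ u I - y / Q * (1 - a K I / (2 * ν * y)) + s I * (y ^ 2 / (4 * Q ^ 2)) +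
        y / (8 * Q) := by
      have := hcs I
      nlinarith [mul_nonneg hyQ (har I)]
    refine mul_nonneg (hV I).le (add_nonneg (mul_nonneg (by positivity) (by linarith))
      (mul_nonneg hC0.le h2))
  -- The two stopping rules, large oscillation or small weight. In either case the potential pays
  -- the bound that the outer induction gives for a fresh start at `I`.
  have hG2 : ∀ I, a K I ≤ 2 * q * ν * y → (2 * ν * y < a K I ∨ u I < y / (8 * Q)) →
      C * (V I * u I) ≤ G I := by
    intro I hI hst
    have hf := hfirst I hI
    have h2 : u I ≤ u I - y / Q * (1 - a K I / (2 * ν * y)) + s I * (y ^ 2 / (4 * Q ^ 2)) +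
        y / (8 * Q) := by
      rcases hst with h | h
      · have : 1 ≤ a K I / (2 * ν * y) := by rw [le_div_iff₀ (by positivity)]; linarith
        have := mul_nonneg hyQ (sub_nonneg.2 this)
        linarith [hs4 I]
      · have := hcs I
        nlinarith [mul_nonneg hyQ (har I)]
    have h3 : C * u I ≤ 8 * Q * q / y * (2 * q * ν * y * a K I - ‖β I - β K‖ ^ 2) +
        C * (u I - y / Q * (1 - a K I / (2 * ν * y)) + s I * (y ^ 2 / (4 * Q ^ 2)) +
          y / (8 * Q)) := by
      have := mul_le_mul_of_nonneg_left h2 hC0.le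
      have : 0 ≤ 8 * Q * q / y * (2 * q * ν * y * a K I - ‖β I - β K‖ ^ 2) :=
        mul_nonneg (by positivity) (by linarith)
      linarith
    have := mul_le_mul_of_nonneg_left h3 (hV I).le
    simp only [hG]; linarith
  -- Every term of `G` except -‖β I - β K‖² is affine in martingales and is conserved. The squared
  -- term decreases by the variance of the children, and u I ≥ y/(8Q) makes this cover `d I`.
  have hG3 : ∀ I, y / (8 * Q) ≤ u I → d I + ∑ i, G (child I i) ≤ G I := by
    intro I hI
    have e : ∑ i, G (child I i) = V I / q * (8 * Q * q / y * (2 * q * ν * y * (q * a K I) -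
        ∑ i, ‖β (child I i) - β K‖ ^ 2) +
        C * (q * u I - y / Q * (q - q * a K I / (2 * ν * y)) +
          q * s I * (y ^ 2 / (4 * Q ^ 2)) + q * (y / (8 * Q)))) := by
      have hv : ∀ i, V (child I i) = V I / q := fun i => by
        rw [← hVc I i]; field_simp
      simp only [hG, hv]
      rw [← Finset.mul_sum]
      simp only [Finset.sum_add_distrib, ← Finset.mul_sum, Finset.sum_sub_distrib, hum, ham,
        ← Finset.sum_mul, ← Finset.sum_div, hsm, Finset.sum_const, Finset.card_univ,
        nsmul_eq_mul, mul_one]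
      rw [← hqdef]; ring
    have hsq := sum_sq_norm_sub (hβm I) (β K)
    have hdI : d I ≤ V I / q * (8 * Q * q / y * (∑ i, ‖β (child I i) - β I‖ ^ 2)) := by
      have hS : 0 ≤ ∑ i, ‖β (child I i) - β I‖ ^ 2 := Finset.sum_nonneg fun i _ => sq_nonneg _
      have : V I * (∑ i, ‖β (child I i) - β I‖ ^ 2) / u I ≤
          V I * (∑ i, ‖β (child I i) - β I‖ ^ 2) / (y / (8 * Q)) := by
        have := (hV I).le
        gcongr
      refine this.trans (le_of_eq ?_)
      field_simp
    rw [e]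
    refine (add_le_add_left hdI _).trans (le_of_eq ?_)
    rw [hsq, ← hqdef]
    simp only [hG]
    field_simp
    ring
  -- Oscillation overshoots by at most a factor `q` at the stopping cube, hence the threshold 2qνy
  -- throughout.
  have hchild : ∀ I i, a K I ≤ 2 * ν * y → a K (child I i) ≤ 2 * q * ν * y := by
    intro I i h
    have : a K (child I i) ≤ q * a K I := by
      rw [← ham K I]
      exact Finset.single_le_sum (f := fun i => a K (child I i)) (fun j _ => ha0 _)
        (Finset.mem_univ i)
    nlinarith
  have inner : ∀ k, k < N → ∀ I, p I → a K I ≤ 2 * q * ν * y → treeSum child d k I ≤ G I := by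
    intro k
    induction k with
    | zero => intro _ I _ hI; exact hG1 I hI
    | succ k ih =>
      intro hk I hpI hI
      by_cases hst : 2 * ν * y < a K I ∨ u I < y / (8 * Q)
      · exact (ihN (k + 1) hk I hpI).trans (hG2 I hI hst)
      · push Not at hst
        refine le_trans ?_ (hG3 I hst.2)
        exact add_le_add_right (Finset.sum_le_sum fun i _ =>
          ih (by omega) _ (hp I hpI i) (hchild I i hst.1)) _
  have hKν : a K K ≤ ν * y := ha K hK
  have hunst : y / (8 * Q) ≤ u K := div_le_self hy0.le (by linarith)
  -- At the root, the bracket multiplying C is at most y - y/2Q + y/4Q + y/8Q = y - y/(8Q).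
  have hfin : G K ≤ C * (V K * y) := by
    have hsy : s K * (y ^ 2 / (4 * Q ^ 2)) ≤ y / (4 * Q) := by
      have : s K * (y ^ 2 / (4 * Q ^ 2)) = (y * s K) * (y / (4 * Q ^ 2)) := by ring
      rw [this]
      refine (mul_le_mul_of_nonneg_right (hQ K) (by positivity)).trans (le_of_eq ?_)
      field_simp
    have h2 : a K K / (2 * ν * y) ≤ 1 / 2 := by
      rw [div_le_iff₀ (by positivity)]; linarith
    have h3 : y / Q * (1 / 2) ≤ y / Q * (1 - a K K / (2 * ν * y)) :=
      mul_le_mul_of_nonneg_left (by linarith) hyQ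
    have h4 : u K - y / Q * (1 - a K K / (2 * ν * y)) + s K * (y ^ 2 / (4 * Q ^ 2)) +
        y / (8 * Q) ≤ y - y / (8 * Q) := by
      have e1 : y / Q = 8 * (y / (8 * Q)) := by field_simp
      have e2 : y / (4 * Q) = 2 * (y / (8 * Q)) := by field_simp; norm_num
      linarith
    have h5 : 8 * Q * q / y * (2 * q * ν * y * a K K - ‖β K - β K‖ ^ 2) ≤
        16 * Q * q ^ 2 * ν ^ 2 * y := by
      rw [sub_self, norm_zero]
      calc _ ≤ 8 * Q * q / y * (2 * q * ν * y * (ν * y) - 0 ^ 2) := by gcongr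
        _ = _ := by field_simp; ring
    have h6 : C * (y / (8 * Q)) = 16 * Q * q ^ 2 * ν ^ 2 * y := by
      rw [hC]; field_simp; norm_num
    have h7 := mul_le_mul_of_nonneg_left h4 hC0.le
    have h8 : 8 * Q * q / y * (2 * q * ν * y * a K K - ‖β K - β K‖ ^ 2) +
        C * (u K - y / Q * (1 - a K K / (2 * ν * y)) + s K * (y ^ 2 / (4 * Q ^ 2)) +
          y / (8 * Q)) ≤ C * y := by linarith
    have := mul_le_mul_of_nonneg_left h8 (hV K).le
    simp only [hG]; linarith
  -- The first splitting is done by hand: `inner` needs strictly fewer than `N` generations, and the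
  -- root is not stopped.
  cases N with
  | zero => have := (hV K).le; simp only [treeSum]; positivity
  | succ N =>
    refine le_trans ?_ ((hG3 K hunst).trans hfin)
    exact add_le_add_right (Finset.sum_le_sum fun i _ =>
      inner N (by omega) _ (hp K hK i) (hchild K i (by nlinarith))) _

end Tree

/-! ### Geometry of cubes and their children -/

section Cubes

variable {n : ℕ}

theorem Cube.eq_of_corner_side {K L : Cube n} (hc : K.corner = L.corner) (hs : K.side = L.side) : K = L := by
  cases K; cases L; simp_all

theorem Cube.mem_toSet {K : Cube n} {x : Fin n → ℝ} :
    x ∈ K.toSet ↔ ∀ i, K.corner i ≤ x i ∧ x i < K.corner i + K.side := by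
  simp [Cube.toSet]

theorem Cube.corner_mem (K : Cube n) : K.corner ∈ K.toSet :=
  Cube.mem_toSet.2 fun i => ⟨le_rfl, by linarith [K.side_pos]⟩

theorem Cube.measurableSet (K : Cube n) : MeasurableSet K.toSet :=
  MeasurableSet.univ_pi fun _ => measurableSet_Ico

/-- The Lebesgue measure of a cube. -/
noncomputable def Cube.vol (K : Cube n) : ℝ := K.side ^ n

theorem Cube.vol_pos (K : Cube n) : 0 < K.vol := pow_pos K.side_pos n

theorem Cube.volume_eq (K : Cube n) : volume K.toSet = ENNReal.ofReal K.vol := by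
  simp [Cube.toSet, volume_pi_pi, Cube.vol, ENNReal.ofReal_pow K.side_pos.le]

/-- The dyadic child of `K` in the corner selected by `ε`. -/
noncomputable def Cube.child (K : Cube n) (ε : Fin n → Bool) : Cube n where
  corner i := K.corner i + if ε i then K.side / 2 else 0
  side := K.side / 2
  side_pos := half_pos K.side_pos

theorem Cube.card_mul_vol_child (K : Cube n) (ε : Fin n → Bool) :
    (Fintype.card (Fin n → Bool) : ℝ) * (K.child ε).vol = K.vol := by
  simp [Cube.vol, Cube.child, div_pow, mul_div_cancel₀]

theorem Cube.child_subset (K : Cube n) (ε : Fin n → Bool) : (K.child ε).toSet ⊆ K.toSet := by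
  intro x hx
  rw [Cube.mem_toSet] at hx ⊢
  intro i
  have := hx i
  have hp := K.side_pos
  simp only [Cube.child] at this
  split_ifs at this <;> constructor <;> linarith

theorem Cube.exists_mem_child {K : Cube n} {x : Fin n → ℝ} (hx : x ∈ K.toSet) :
    ∃ ε, x ∈ (K.child ε).toSet := by
  rw [Cube.mem_toSet] at hx
  refine ⟨fun i => decide (K.corner i + K.side / 2 ≤ x i), Cube.mem_toSet.2 fun i => ?_⟩
  have := hx i
  by_cases h : K.corner i + K.side / 2 ≤ x i
  · simp only [Cube.child, h, decide_true, if_true]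
    exact ⟨trivial, by linarith⟩
  · simp only [Cube.child, h, decide_false, Bool.false_eq_true, if_false]
    push Not at h
    constructor <;> linarith

theorem Cube.iUnion_child (K : Cube n) : ⋃ ε, (K.child ε).toSet = K.toSet :=
  Subset.antisymm (iUnion_subset K.child_subset) fun _ hx => mem_iUnion.2 (Cube.exists_mem_child hx)

theorem Cube.disjoint_child (K : Cube n) : Pairwise fun ε ε' =>
    Disjoint (K.child ε).toSet (K.child ε').toSet := by
  intro ε ε' h
  rw [Set.disjoint_left]
  intro x hx hx'
  apply h
  rw [Cube.mem_toSet] at hx hx'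
  funext i
  have h1 := hx i
  have h2 := hx' i
  simp only [Cube.child] at h1 h2
  cases e : ε i <;> cases e' : ε' i <;> simp only [e, e', if_true, Bool.false_eq_true, if_false] at h1 h2 ⊢ <;>
    linarith

theorem Cube.side_le_of_subset (hn : 0 < n) {K L : Cube n} (h : K.toSet ⊆ L.toSet) :
    K.side ≤ L.side := by
  by_contra! hlt
  let i : Fin n := ⟨0, hn⟩
  have h1 := Cube.mem_toSet.1 (h K.corner_mem) i
  have hx : (fun j => K.corner j + if j = i then L.side else 0) ∈ K.toSet := by
    refine Cube.mem_toSet.2 fun j => ?_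
    have := K.side_pos
    have := L.side_pos
    split_ifs <;> constructor <;> linarith
  have h2 := Cube.mem_toSet.1 (h hx) i
  simp only [if_true] at h2
  linarith

theorem Cube.eq_of_subset {K L : Cube n} (h : K.toSet ⊆ L.toSet)
    (hs : K.side = L.side) : K = L := by
  refine Cube.eq_of_corner_side (funext fun i => ?_) hs
  have h1 := Cube.mem_toSet.1 (h K.corner_mem) i
  by_contra hne
  have hlt : L.corner i < K.corner i := lt_of_le_of_ne h1.1 (Ne.symm hne)
  have hx : (fun j => K.corner j + if j = i then L.side - (K.corner i - L.corner i) else 0)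
      ∈ K.toSet := by
    refine Cube.mem_toSet.2 fun j => ?_
    have := K.side_pos
    split_ifs <;> constructor <;> linarith
  have h2 := Cube.mem_toSet.1 (h hx) i
  simp only [if_true] at h2
  linarith

end Cubes

/-! ### Dyadic grids: children, maximal cubes, descendants -/

section Grid

variable {n : ℕ} {D : Set (Cube n)}

theorem IsDyadicGrid.eq_of_mem (hD : IsDyadicGrid D) {K L : Cube n} (hK : K ∈ D) (hL : L ∈ D)
    (hs : K.side = L.side) {x : Fin n → ℝ} (hxK : x ∈ K.toSet) (hxL : x ∈ L.toSet) : K = L := by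
  obtain ⟨k, hk⟩ := hD.side_eq K hK
  exact (hD.partition k x).unique ⟨hK, hk, hxK⟩ ⟨hL, hs ▸ hk, hxL⟩

theorem IsDyadicGrid.exists_half (hD : IsDyadicGrid D) (hn : 0 < n) {K : Cube n} (hK : K ∈ D)
    {x : Fin n → ℝ} (hx : x ∈ K.toSet) :
    ∃ L ∈ D, L.side = K.side / 2 ∧ x ∈ L.toSet ∧ L.toSet ⊆ K.toSet := by
  obtain ⟨k, hk⟩ := hD.side_eq K hK
  obtain ⟨L, ⟨hL, hLs, hxL⟩, -⟩ := hD.partition (k - 1) x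
  have hs : L.side = K.side / 2 := by
    rw [hLs, hk, zpow_sub₀ two_ne_zero, zpow_one]
  refine ⟨L, hL, hs, hxL, ?_⟩
  rcases hD.nested L hL K hK with h | h | h
  · exact h
  · have := Cube.side_le_of_subset hn h
    have := K.side_pos
    linarith
  · exact absurd hx (Set.disjoint_left.1 h hxL)

/-- If the corner of `L` lies left of the midpoint in direction i, slide it to the face of `K`. The
half-size grid cube containing the new point has its corner on that face and still contains the
corner of `L`, so it is `L`. -/
theorem IsDyadicGrid.corner_half (hD : IsDyadicGrid D) (hn : 0 < n) {K L : Cube n} (hK : K ∈ D)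
    (hL : L ∈ D) (hs : L.side = K.side / 2) (hLK : L.toSet ⊆ K.toSet) (i : Fin n) :
    L.corner i = K.corner i ∨ L.corner i = K.corner i + K.side / 2 := by
  have hp := K.side_pos
  have hc := Cube.mem_toSet.1 (hLK L.corner_mem)
  have hle : L.corner i + L.side ≤ K.corner i + K.side := by
    by_contra! hlt
    have hx : (fun j => L.corner j + if j = i then K.corner i + K.side - L.corner i else 0)
        ∈ L.toSet := by
      refine Cube.mem_toSet.2 fun j => ?_
      have := L.side_pos
      split_ifs with h
      · subst h; constructor <;> linarith [hc j]
      · constructor <;> linarith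
    have h2 := Cube.mem_toSet.1 (hLK hx) i
    simp only [if_true] at h2
    linarith
  by_cases hcase : L.corner i < K.corner i + K.side / 2
  · left
    have hy : Function.update L.corner i (K.corner i) ∈ K.toSet := by
      refine Cube.mem_toSet.2 fun j => ?_
      by_cases h : j = i
      · subst h; simp [hp]
      · simpa [h] using hc j
    obtain ⟨M, hM, hMs, hyM, hMK⟩ := hD.exists_half hn hK hy
    have hm := Cube.mem_toSet.1 hyM
    have hMi : M.corner i = K.corner i := by
      have h1 := (hm i).1
      have h2 := (Cube.mem_toSet.1 (hMK M.corner_mem) i).1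
      simp only [Function.update_self] at h1
      linarith
    have hLM : L.corner ∈ M.toSet := by
      refine Cube.mem_toSet.2 fun j => ?_
      by_cases h : j = i
      · subst h; rw [hMi, hMs]; exact ⟨(hc j).1, hcase⟩
      · simpa [h] using hm j
    rw [hD.eq_of_mem hL hM (hs.trans hMs.symm) L.corner_mem hLM, hMi]
  · right
    linarith

theorem IsDyadicGrid.child_mem (hD : IsDyadicGrid D) (hn : 0 < n) {K : Cube n} (hK : K ∈ D)
    (ε : Fin n → Bool) : K.child ε ∈ D := by
  have hp := K.side_pos
  obtain ⟨L, hL, hs, hx, hLK⟩ :=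
    hD.exists_half hn hK (K.child_subset ε (K.child ε).corner_mem)
  suffices h : K.child ε = L by rw [h]; exact hL
  refine Cube.eq_of_corner_side (funext fun i => ?_) hs.symm
  have h1 := Cube.mem_toSet.1 hx i
  have h2 := hD.corner_half hn hK hL hs hLK i
  simp only [Cube.child] at h1 ⊢
  rcases h2 with h2 | h2 <;> split_ifs at h1 ⊢ <;> linarith

theorem IsDyadicGrid.subset_child (hD : IsDyadicGrid D) (hn : 0 < n) {K L : Cube n} (hK : K ∈ D)
    (hL : L ∈ D) (hLK : L.toSet ⊆ K.toSet) (hne : L ≠ K) :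
    ∃ ε, L.toSet ⊆ (K.child ε).toSet := by
  obtain ⟨ε, hε⟩ := Cube.exists_mem_child (hLK L.corner_mem)
  refine ⟨ε, ?_⟩
  have hle := Cube.side_le_of_subset hn hLK
  have hlt : L.side < K.side := lt_of_le_of_ne hle fun h => hne (Cube.eq_of_subset hLK h)
  -- Both sides are powers of two, so a strict inequality loses a factor of two.
  have hhalf : L.side ≤ K.side / 2 := by
    obtain ⟨k, hk⟩ := hD.side_eq K hK
    obtain ⟨l, hl⟩ := hD.side_eq L hL
    rw [hk, hl] at hlt ⊢
    have h := (zpow_lt_zpow_iff_right₀ (one_lt_two (α := ℝ))).1 hlt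
    calc (2 : ℝ) ^ l ≤ 2 ^ (k - 1) := zpow_le_zpow_right₀ one_le_two (by omega)
      _ = _ := by rw [zpow_sub₀ two_ne_zero, zpow_one]
  rcases hD.nested L hL _ (hD.child_mem hn hK ε) with h | h | h
  · exact h
  · have : K.child ε = L := Cube.eq_of_subset h (le_antisymm (Cube.side_le_of_subset hn h) hhalf)
    rw [this]
  · exact absurd hε (Set.disjoint_left.1 h L.corner_mem)

theorem sum_biUnion_le {ι κ : Type*} [DecidableEq κ] (s : Finset ι) (t : ι → Finset κ) {f : κ → ℝ}
    (hf : ∀ x, 0 ≤ f x) : ∑ x ∈ s.biUnion t, f x ≤ ∑ i ∈ s, ∑ x ∈ t i, f x := by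
  classical
  induction s using Finset.induction_on with
  | empty => simp
  | insert i s hi ih =>
    rw [Finset.biUnion_insert, Finset.sum_insert hi]
    have := Finset.sum_union_inter (s₁ := t i) (s₂ := s.biUnion t) (f := f)
    have : 0 ≤ ∑ x ∈ t i ∩ s.biUnion t, f x := Finset.sum_nonneg fun x _ => hf x
    linarith

theorem IsDyadicGrid.sum_le_treeSum (hD : IsDyadicGrid D) (hn : 0 < n) {d : Cube n → ℝ}
    (hd : ∀ K, 0 ≤ d K) (N : ℕ) {K : Cube n} (hK : K ∈ D) (F : Finset (Cube n))
    (hF : ∀ L ∈ F, L ∈ D ∧ L.toSet ⊆ K.toSet ∧ K.side < 2 ^ N * L.side) :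
    ∑ L ∈ F, d L ≤ treeSum Cube.child d N K := by
  classical
  induction N generalizing K F with
  | zero =>
    have : F = ∅ := by
      refine Finset.eq_empty_of_forall_notMem fun L hL => ?_
      have h := hF L hL
      have := Cube.side_le_of_subset hn h.2.1
      have := h.2.2
      simp only [pow_zero, one_mul] at this
      linarith
    simp [this, treeSum]
  | succ N ih =>
    have hsub : F ⊆ insert K (Finset.univ.biUnion fun ε =>
        F.filter fun L => L.toSet ⊆ (K.child ε).toSet) := by
      intro L hL
      by_cases h : L = K
      · simp [h]
      · obtain ⟨ε, hε⟩ := hD.subset_child hn hK (hF L hL).1 (hF L hL).2.1 h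
        exact Finset.mem_insert_of_mem (Finset.mem_biUnion.2
          ⟨ε, Finset.mem_univ _, Finset.mem_filter.2 ⟨hL, hε⟩⟩)
    calc ∑ L ∈ F, d L ≤ _ := Finset.sum_le_sum_of_subset_of_nonneg hsub fun L _ _ => hd L
      _ ≤ d K + ∑ L ∈ Finset.univ.biUnion fun ε =>
          F.filter fun L => L.toSet ⊆ (K.child ε).toSet, d L := by
        by_cases h : K ∈ Finset.univ.biUnion fun ε =>
          F.filter fun L => L.toSet ⊆ (K.child ε).toSet
        · rw [Finset.insert_eq_of_mem h]; linarith [hd K]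
        · rw [Finset.sum_insert h]
      _ ≤ d K + ∑ ε, ∑ L ∈ F.filter fun L => L.toSet ⊆ (K.child ε).toSet, d L := by
        gcongr
        exact sum_biUnion_le _ _ hd
      _ ≤ _ := by
        simp only [treeSum]
        gcongr with ε
        refine ih (hD.child_mem hn hK ε) _ fun L hL => ?_
        rw [Finset.mem_filter] at hL
        refine ⟨(hF L hL.1).1, hL.2, ?_⟩
        have := (hF L hL.1).2.2
        rw [pow_succ] at this
        simp only [Cube.child]
        linarith

/-- The number of generations from `K` down to side length `2 ^ k`. -/
noncomputable def depth (k : ℤ) (K : Cube n) : ℕ := (Int.log 2 K.side - k).toNat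

theorem IsDyadicGrid.side_eq_depth (hD : IsDyadicGrid D) {K : Cube n} (hK : K ∈ D) {k : ℤ}
    (hk : (2 : ℝ) ^ k < K.side) : K.side = 2 ^ depth k K * (2 : ℝ) ^ k := by
  obtain ⟨l, hl⟩ := hD.side_eq K hK
  have h1 : Int.log 2 K.side = l := by
    rw [hl]; exact_mod_cast Int.log_zpow (R := ℝ) one_lt_two l
  rw [hl] at hk
  have h := (zpow_lt_zpow_iff_right₀ (one_lt_two (α := ℝ))).1 hk
  rw [depth, h1, hl, ← zpow_natCast, ← zpow_add₀ two_ne_zero]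
  congr 1
  omega

/-- The maximal cubes of a finite family dominate its sums by sums over trees. -/
theorem IsDyadicGrid.exists_maximal (hD : IsDyadicGrid D) (hn : 0 < n) {k : ℤ}
    (F : Finset (Cube n)) (hF : ∀ K ∈ F, K ∈ D ∧ (2 : ℝ) ^ k < K.side) :
    ∃ M ⊆ F, (M : Set (Cube n)).PairwiseDisjoint Cube.toSet ∧
      ∀ d : Cube n → ℝ, (∀ K, 0 ≤ d K) →
        ∑ K ∈ F, d K ≤ ∑ K ∈ M, treeSum Cube.child d (depth k K) K := by
  classical
  -- The maximal cubes under inclusion; nestedness makes them disjoint.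
  set M := F.filter fun K => ∀ L ∈ F, K.toSet ⊆ L.toSet → L = K with hM
  refine ⟨M, Finset.filter_subset _ _, ?_, fun d hd => ?_⟩
  · intro K hK L hL hne
    rw [Finset.mem_coe, hM, Finset.mem_filter] at hK hL
    rcases hD.nested K (hF K hK.1).1 L (hF L hL.1).1 with h | h | h
    · exact absurd (hK.2 L hL.1 h).symm hne
    · exact absurd (hL.2 K hK.1 h) hne
    · exact h
  · have hcov : F ⊆ M.biUnion fun K => F.filter fun L => L.toSet ⊆ K.toSet := by
      intro L hL
      obtain ⟨K, hK, hmax⟩ := (F.filter fun K => L.toSet ⊆ K.toSet).exists_max_image Cube.side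
        ⟨L, Finset.mem_filter.2 ⟨hL, Subset.rfl⟩⟩
      rw [Finset.mem_filter] at hK
      refine Finset.mem_biUnion.2 ⟨K, Finset.mem_filter.2 ⟨hK.1, fun K' hK' hsub => ?_⟩,
        Finset.mem_filter.2 ⟨hL, hK.2⟩⟩
      have := hmax K' (Finset.mem_filter.2 ⟨hK', hK.2.trans hsub⟩)
      exact (Cube.eq_of_subset hsub (le_antisymm (Cube.side_le_of_subset hn hsub) this)).symm
    calc ∑ K ∈ F, d K ≤ _ := Finset.sum_le_sum_of_subset_of_nonneg hcov fun L _ _ => hd L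
      _ ≤ ∑ K ∈ M, ∑ L ∈ F.filter fun L => L.toSet ⊆ K.toSet, d L :=
        sum_biUnion_le _ _ hd
      _ ≤ _ := by
        refine Finset.sum_le_sum fun K hK => ?_
        have hK' := hF K (Finset.mem_filter.1 hK).1
        refine hD.sum_le_treeSum hn hd _ hK'.1 _ fun L hL => ?_
        rw [Finset.mem_filter] at hL
        refine ⟨(hF L hL.1).1, hL.2, ?_⟩
        conv_lhs => rw [hD.side_eq_depth hK'.1 hK'.2]
        have := (hF L hL.1).2
        gcongr

open Classical in
/-- The descendants of `K` of generation `N`. -/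
noncomputable def leaves : ℕ → Cube n → Finset (Cube n)
  | 0, K => {K}
  | N + 1, K => Finset.univ.biUnion fun ε => leaves N (K.child ε)

theorem subset_of_mem_leaves {N : ℕ} {K P : Cube n} (h : P ∈ leaves N K) :
    P.toSet ⊆ K.toSet := by
  classical
  induction N generalizing K with
  | zero => simp [leaves] at h; rw [h]
  | succ N ih =>
    simp only [leaves, Finset.mem_biUnion, Finset.mem_univ, true_and] at h
    obtain ⟨ε, hε⟩ := h
    exact (ih hε).trans (K.child_subset ε)

theorem side_of_mem_leaves {N : ℕ} {K P : Cube n} (h : P ∈ leaves N K) :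
    2 ^ N * P.side = K.side := by
  classical
  induction N generalizing K with
  | zero => simp [leaves] at h; simp [h]
  | succ N ih =>
    simp only [leaves, Finset.mem_biUnion, Finset.mem_univ, true_and] at h
    obtain ⟨ε, hε⟩ := h
    have := ih hε
    simp only [Cube.child] at this
    rw [pow_succ]; linarith

theorem IsDyadicGrid.mem_of_mem_leaves (hD : IsDyadicGrid D) (hn : 0 < n) {N : ℕ} {K P : Cube n}
    (hK : K ∈ D) (h : P ∈ leaves N K) : P ∈ D := by
  classical
  induction N generalizing K with
  | zero => simp [leaves] at h; rwa [h]
  | succ N ih =>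
    simp only [leaves, Finset.mem_biUnion, Finset.mem_univ, true_and] at h
    obtain ⟨ε, hε⟩ := h
    exact ih (hD.child_mem hn hK ε) hε

theorem disjoint_leaves {N N' : ℕ} {K K' : Cube n} (h : Disjoint K.toSet K'.toSet) :
    Disjoint (leaves N K) (leaves N' K') := by
  rw [Finset.disjoint_left]
  intro P hP hP'
  exact Set.disjoint_left.1 h (subset_of_mem_leaves hP P.corner_mem)
    (subset_of_mem_leaves hP' P.corner_mem)

theorem leafSum_eq_sum_leaves (g : Cube n → ℝ) (N : ℕ) (K : Cube n) :
    leafSum Cube.child g N K = ∑ P ∈ leaves N K, g P := by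
  classical
  induction N generalizing K with
  | zero => simp [leafSum, leaves]
  | succ N ih =>
    simp only [leafSum, leaves, ih]
    rw [Finset.sum_biUnion]
    intro ε _ ε' _ hne
    exact disjoint_leaves (K.disjoint_child hne)

end Grid

/-! ### Haar functions as signed sums over children -/

section Haar

variable {n : ℕ}

/-- The sign of the Haar function of signature `η` on the child selected by `ε`. -/
def haarSign (η ε : Fin n → Bool) : ℝ := ∏ i, if η i && ε i then -1 else 1

theorem abs_haarSign (η ε : Fin n → Bool) : |haarSign η ε| = 1 := by
  rw [haarSign, Finset.abs_prod]
  refine Finset.prod_eq_one fun i _ => ?_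
  split_ifs <;> simp

/-- The sum factors over coordinates, and a coordinate with η i = 1 contributes 1 - 1. -/
theorem sum_haarSign {η : Fin n → Bool} (hη : η ∈ cancellative n) :
    ∑ ε, haarSign η ε = 0 := by
  classical
  simp only [cancellative, Finset.mem_filter, Finset.mem_univ, true_and] at hη
  obtain ⟨i, hi⟩ := Function.ne_iff.1 hη
  have h := Finset.prod_univ_sum (fun _ : Fin n => (Finset.univ : Finset Bool))
    (fun i e => if η i && e then (-1 : ℝ) else 1)
  rw [Fintype.piFinset_univ] at h
  simp only [haarSign]
  rw [← h]
  refine Finset.prod_eq_zero (Finset.mem_univ i) ?_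
  have : η i = true := by simpa using hi
  simp [this]

theorem haarOne_eq {a l : ℝ} (hl : 0 < l) (b : Bool) (t : ℝ) :
    haarOne a l b t = ∑ e : Bool, (√l)⁻¹ * ((if b && e then -1 else 1) *
      (Ico (a + if e then l / 2 else 0) (a + (if e then l / 2 else 0) + l / 2)).indicator 1 t) := by
  have h2 : a + l / 2 + l / 2 = a + l := by ring
  cases b
  · have h : (Ico a (a + l)).indicator (1 : ℝ → ℝ) t =
        (Ico a (a + l / 2)).indicator 1 t + (Ico (a + l / 2) (a + l)).indicator 1 t := by
      rw [← Ico_union_Ico_eq_Ico (b := a + l / 2) (by linarith) (by linarith),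
        indicator_union_of_disjoint (by simp)]
    simp [haarOne, h, h2]; ring
  · simp [haarOne, h2]; ring

theorem haar_eq (K : Cube n) (η : Fin n → Bool) (x : Fin n → ℝ) :
    haar K η x = (√K.vol)⁻¹ * ∑ ε, haarSign η ε * (K.child ε).toSet.indicator 1 x := by
  classical
  have hv : √K.vol = √K.side ^ n := by
    rw [Cube.vol, Real.sqrt_eq_iff_mul_self_eq (by have := K.side_pos; positivity) (by positivity),
      ← mul_pow, Real.mul_self_sqrt K.side_pos.le]
  simp only [haar, haarOne_eq K.side_pos]
  rw [Finset.prod_univ_sum, Fintype.piFinset_univ, Finset.mul_sum]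
  refine Finset.sum_congr rfl fun ε _ => ?_
  rw [Finset.prod_mul_distrib, Finset.prod_mul_distrib, Finset.prod_const, Finset.card_univ,
    Fintype.card_fin, hv, inv_pow, haarSign]
  congr 2
  by_cases h : x ∈ (K.child ε).toSet
  · rw [indicator_of_mem h, Pi.one_apply]
    refine Finset.prod_eq_one fun i _ => ?_
    exact indicator_of_mem (s := Ico _ _) (Cube.mem_toSet.1 h i) _
  · rw [indicator_of_notMem h]
    rw [Cube.mem_toSet] at h
    push Not at h
    obtain ⟨i, hi⟩ := h
    refine Finset.prod_eq_zero (Finset.mem_univ i) (indicator_of_notMem ?_ _)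
    rintro ⟨h1, h2⟩
    exact absurd h2 (not_lt.2 (hi h1))

end Haar

/-! ### Averages over rectangles as martingales in each variable -/

section Average

variable {n m : ℕ} {E : Type*} [NormedAddCommGroup E]

theorem measurableSet_rect (I : Cube n) (J : Cube m) : MeasurableSet (rect I J) :=
  I.measurableSet.prod J.measurableSet

theorem volume_rect (I : Cube n) (J : Cube m) :
    volume (rect I J) = ENNReal.ofReal (I.vol * J.vol) := by
  rw [rect, Measure.volume_eq_prod, Measure.prod_prod, I.volume_eq, J.volume_eq,
    ENNReal.ofReal_mul I.vol_pos.le]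

theorem volume_rect_lt_top (I : Cube n) (J : Cube m) : volume (rect I J) < ∞ := by
  rw [volume_rect]; exact ENNReal.ofReal_lt_top

theorem measureReal_rect (I : Cube n) (J : Cube m) :
    volume.real (rect I J) = I.vol * J.vol := by
  rw [Measure.real, volume_rect, ENNReal.toReal_ofReal (mul_pos I.vol_pos J.vol_pos).le]

theorem iUnion_rect_child_left (I : Cube n) (J : Cube m) :
    ⋃ ε, rect (I.child ε) J = rect I J := by
  simp only [rect]; rw [← I.iUnion_child, iUnion_prod_const]

theorem iUnion_rect_child_right (I : Cube n) (J : Cube m) :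
    ⋃ ε, rect I (J.child ε) = rect I J := by
  simp only [rect]; rw [← J.iUnion_child, prod_iUnion]

/-- Integrability over every rectangle. -/
def RectIntegrable (g : (Fin n → ℝ) × (Fin m → ℝ) → E) : Prop :=
  ∀ (I : Cube n) (J : Cube m), IntegrableOn g (rect I J)

theorem rectIntegrable_of_locallyIntegrable {g : (Fin n → ℝ) × (Fin m → ℝ) → E}
    (hg : LocallyIntegrable g volume) : RectIntegrable g := by
  intro I J
  have h : rect I J ⊆ (Set.pi univ fun i => Icc (I.corner i) (I.corner i + I.side)) ×ˢ
      (Set.pi univ fun i => Icc (J.corner i) (J.corner i + J.side)) :=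
    prod_mono (Set.pi_mono fun i _ => Ico_subset_Icc_self) (Set.pi_mono fun i _ => Ico_subset_Icc_self)
  refine (hg.integrableOn_isCompact (IsCompact.prod ?_ ?_)).mono_set h <;>
  exact isCompact_univ_pi fun i => isCompact_Icc

theorem RectIntegrable.norm_sub_const {g : (Fin n → ℝ) × (Fin m → ℝ) → E} (hg : RectIntegrable g)
    (c : E) : RectIntegrable fun x => ‖g x - c‖ := fun I J =>
  ((hg I J).sub (integrableOn_const (volume_rect_lt_top I J).ne)).norm

variable [NormedSpace ℝ E]

/-- The average of `g` over `I × J`. -/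
noncomputable def avg (g : (Fin n → ℝ) × (Fin m → ℝ) → E) (I : Cube n) (J : Cube m) : E :=
  (I.vol * J.vol)⁻¹ • ∫ x in rect I J, g x

theorem avg_eq_setAverage (g : (Fin n → ℝ) × (Fin m → ℝ) → E) (I : Cube n) (J : Cube m) :
    avg g I J = ⨍ x in rect I J, g x := by
  rw [setAverage_eq, measureReal_rect, avg]

theorem vol_smul_avg (g : (Fin n → ℝ) × (Fin m → ℝ) → E) (I : Cube n) (J : Cube m) :
    (I.vol * J.vol) • avg g I J = ∫ x in rect I J, g x := by
  rw [avg, smul_inv_smul₀ (mul_pos I.vol_pos J.vol_pos).ne']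

theorem sum_avg_child_left {g : (Fin n → ℝ) × (Fin m → ℝ) → E} (hg : RectIntegrable g)
    (I : Cube n) (J : Cube m) :
    ∑ ε, avg g (I.child ε) J = (Fintype.card (Fin n → Bool) : ℝ) • avg g I J := by
  have h : ∫ x in rect I J, g x = ∑ ε, ∫ x in rect (I.child ε) J, g x := by
    rw [← iUnion_rect_child_left, integral_iUnion_fintype (fun ε => measurableSet_rect _ _)
      (fun ε ε' hne => Disjoint.set_prod_left (I.disjoint_child hne) _ _) fun ε => hg _ _]
  rw [avg, h, smul_smul, Finset.smul_sum]
  refine Finset.sum_congr rfl fun ε _ => ?_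
  rw [avg, ← I.card_mul_vol_child ε]
  congr 1
  have := (I.child ε).vol_pos
  have := J.vol_pos
  field_simp

theorem sum_avg_child_right {g : (Fin n → ℝ) × (Fin m → ℝ) → E} (hg : RectIntegrable g)
    (I : Cube n) (J : Cube m) :
    ∑ δ, avg g I (J.child δ) = (Fintype.card (Fin m → Bool) : ℝ) • avg g I J := by
  have h : ∫ x in rect I J, g x = ∑ δ, ∫ x in rect I (J.child δ), g x := by
    rw [← iUnion_rect_child_right, integral_iUnion_fintype (fun ε => measurableSet_rect _ _)
      (fun ε ε' hne => Disjoint.set_prod_right (J.disjoint_child hne) _ _) fun ε => hg _ _]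
  rw [avg, h, smul_smul, Finset.smul_sum]
  refine Finset.sum_congr rfl fun δ _ => ?_
  rw [avg, ← J.card_mul_vol_child δ]
  congr 1
  have := (J.child δ).vol_pos
  have := I.vol_pos
  field_simp

theorem norm_avg_sub_le [CompleteSpace E] {g : (Fin n → ℝ) × (Fin m → ℝ) → E}
    (hg : RectIntegrable g) (c : E) (I : Cube n) (J : Cube m) :
    ‖avg g I J - c‖ ≤ avg (fun x => ‖g x - c‖) I J := by
  have hV := mul_pos I.vol_pos J.vol_pos
  have h : avg g I J - c = (I.vol * J.vol)⁻¹ • ∫ x in rect I J, (g x - c) := by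
    rw [integral_sub (hg I J) (integrableOn_const (volume_rect_lt_top I J).ne), smul_sub,
      setIntegral_const, measureReal_rect, inv_smul_smul₀ hV.ne', avg]
  rw [h, norm_smul, Real.norm_of_nonneg (by positivity), avg, smul_eq_mul]
  gcongr
  exact norm_integral_le_integral_norm _

end Average

/-! ### One-parameter A₂ bounds for the averages of the weight -/

section Weight

variable {n m : ℕ} {w : (Fin n → ℝ) × (Fin m → ℝ) → ℝ}

theorem weightOf_rect_eq (hw : RectIntegrable w) (h0 : ∀ᵐ x, 0 < w x) (I : Cube n) (J : Cube m) :
    weightOf w (rect I J) = ENNReal.ofReal (I.vol * J.vol * avg w I J) := by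
  rw [← smul_eq_mul, vol_smul_avg, weightOf, ofReal_integral_eq_lintegral_ofReal (hw I J)
    (ae_restrict_of_ae (h0.mono fun x hx => hx.le))]

theorem weightAvg_eq (hw : RectIntegrable w) (h0 : ∀ᵐ x, 0 < w x) (I : Cube n) (J : Cube m) :
    weightAvg w I J = ENNReal.ofReal (avg w I J) := by
  have hV := mul_pos I.vol_pos J.vol_pos
  rw [weightAvg, weightOf_rect_eq hw h0, volume_rect, ← ENNReal.ofReal_div_of_pos hV,
    mul_div_cancel_left₀ _ hV.ne']

theorem IsA2Weight.ae_inv_pos (hw : IsA2Weight w) : ∀ᵐ x, 0 < (w x)⁻¹ :=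
  hw.ae_pos.mono fun _ hx => inv_pos.2 hx

theorem IsA2Weight.rectIntegrable (hw : IsA2Weight w) : RectIntegrable w :=
  rectIntegrable_of_locallyIntegrable hw.locallyIntegrable

theorem weightAvg_mul_le (w : (Fin n → ℝ) × (Fin m → ℝ) → ℝ) (I : Cube n) (J : Cube m) :
    weightAvg w I J * weightAvg (fun x => (w x)⁻¹) I J ≤ A2Const w :=
  le_iSup₂ (f := fun I J => weightAvg w I J * weightAvg (fun x => (w x)⁻¹) I J) I J

theorem IsA2Weight.weightOf_ne_zero (hw : IsA2Weight w) (I : Cube n) (J : Cube m) :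
    weightOf w (rect I J) ≠ 0 := by
  intro h
  rw [weightOf, lintegral_eq_zero_iff' (hw.locallyIntegrable.aestronglyMeasurable.aemeasurable.ennreal_ofReal.restrict)] at h
  have h2 : ∀ᵐ x ∂(volume.restrict (rect I J)), False := by
    filter_upwards [h, ae_restrict_of_ae hw.ae_pos] with x hx hx'
    simp at hx
    linarith
  rw [ae_iff] at h2
  simp only [not_false_eq_true, ofPred_true, Measure.restrict_apply_univ, volume_rect,
    ENNReal.ofReal_eq_zero] at h2
  linarith [mul_pos I.vol_pos J.vol_pos]

/-- The average of `w` is nonzero, so an infinite average of `w⁻¹` would make the A₂ constant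
infinite. -/
theorem IsA2Weight.rectIntegrable_inv (hw : IsA2Weight w) : RectIntegrable fun x => (w x)⁻¹ := by
  intro I J
  refine ⟨(hw.locallyIntegrable.aestronglyMeasurable.aemeasurable.inv.aestronglyMeasurable).restrict,
    ?_⟩
  rw [hasFiniteIntegral_iff_ofReal (ae_restrict_of_ae (hw.ae_inv_pos.mono fun x hx => hx.le))]
  have h := (weightAvg_mul_le w I J).trans_lt hw.const_lt_top
  have h0 : weightAvg w I J ≠ 0 :=
    ENNReal.div_ne_zero.2 ⟨hw.weightOf_ne_zero I J, (volume_rect_lt_top I J).ne⟩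
  have h1 : weightAvg (fun x => (w x)⁻¹) I J < ∞ := by
    by_contra hc
    rw [not_lt, top_le_iff] at hc
    rw [hc, ENNReal.mul_top h0] at h
    exact h.ne rfl
  by_contra hc
  exact h1.ne (ENNReal.div_eq_top.2 (Or.inr ⟨not_lt_top_iff.1 hc, (volume_rect_lt_top I J).ne⟩))

/-- Cauchy–Schwarz, from the discriminant of the nonnegative quadratic t ↦ ⟨(w - t)²/w⟩. -/
theorem IsA2Weight.one_le (hw : IsA2Weight w) (I : Cube n) (J : Cube m) :
    1 ≤ avg w I J * avg (fun x => (w x)⁻¹) I J := by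
  have hV := mul_pos I.vol_pos J.vol_pos
  have key : ∀ t : ℝ, 0 ≤ avg (fun x => (w x)⁻¹) I J * (t * t) + (-2) * t + avg w I J := by
    intro t
    have h : 0 ≤ ∫ x in rect I J, ((w x)⁻¹ * (t * t) + (-2) * t + w x) := by
      refine integral_nonneg_of_ae (ae_restrict_of_ae (hw.ae_pos.mono fun x hx => ?_))
      have : (w x)⁻¹ * (t * t) + (-2) * t + w x = (w x - t) ^ 2 / w x := by field_simp; ring
      simp only [Pi.zero_apply]
      rw [this]
      positivity
    have hi := (hw.rectIntegrable_inv I J).mul_const (t * t)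
    have hc : IntegrableOn (fun _ => (-2) * t) (rect I J) :=
      integrableOn_const (volume_rect_lt_top I J).ne
    have hic : IntegrableOn (fun x => (w x)⁻¹ * (t * t) + (-2) * t) (rect I J) := hi.add hc
    rw [integral_add hic (hw.rectIntegrable I J), integral_add hi hc, integral_mul_const,
      setIntegral_const, measureReal_rect, ← vol_smul_avg, ← vol_smul_avg] at h
    simp only [smul_eq_mul] at h
    refine nonneg_of_mul_nonneg_right (a := I.vol * J.vol) ?_ hV
    linarith
  have := discrim_le_zero key
  simp only [discrim] at this
  linarith

theorem IsA2Weight.avg_nonneg {w : (Fin n → ℝ) × (Fin m → ℝ) → ℝ} (h0 : ∀ᵐ x, 0 < w x)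
    (I : Cube n) (J : Cube m) : 0 ≤ avg w I J := by
  have hV := mul_pos I.vol_pos J.vol_pos
  exact mul_nonneg (inv_pos.2 hV).le
    (integral_nonneg_of_ae (ae_restrict_of_ae (h0.mono fun x hx => hx.le)))

theorem IsA2Weight.avg_pos (hw : IsA2Weight w) (I : Cube n) (J : Cube m) : 0 < avg w I J := by
  refine lt_of_le_of_ne (IsA2Weight.avg_nonneg hw.ae_pos I J) fun h => ?_
  have := hw.one_le I J
  rw [← h, zero_mul] at this
  linarith

theorem IsA2Weight.avg_inv_pos (hw : IsA2Weight w) (I : Cube n) (J : Cube m) :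
    0 < avg (fun x => (w x)⁻¹) I J := by
  refine lt_of_le_of_ne (IsA2Weight.avg_nonneg hw.ae_inv_pos I J) fun h => ?_
  have := hw.one_le I J
  rw [← h, mul_zero] at this
  linarith

theorem IsA2Weight.avg_mul_le (hw : IsA2Weight w) (I : Cube n) (J : Cube m) :
    avg w I J * avg (fun x => (w x)⁻¹) I J ≤ (A2Const w).toReal := by
  have h := weightAvg_mul_le w I J
  rw [weightAvg_eq hw.rectIntegrable hw.ae_pos, weightAvg_eq hw.rectIntegrable_inv hw.ae_inv_pos,
    ← ENNReal.ofReal_mul (hw.avg_pos I J).le] at h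
  exact (ENNReal.ofReal_le_iff_le_toReal hw.const_lt_top.ne).1 h

end Weight

/-! ### Little BMO as a bound on averaged oscillation -/

section Oscillation

variable {n m : ℕ} {D : Set (Cube n)} {D' : Set (Cube m)} {w : (Fin n → ℝ) × (Fin m → ℝ) → ℝ}
  {b : (Fin n → ℝ) × (Fin m → ℝ) → ℂ}

theorem avg_osc_le (hw : IsA2Weight w) (hb : RectIntegrable b) {ν : ℝ≥0}
    (hν : littleBMO D D' w b ≤ ν) {I : Cube n} {J : Cube m} (hI : I ∈ D) (hJ : J ∈ D') :
    avg (fun x => ‖b x - avg b I J‖) I J ≤ ν * avg w I J := by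
  have hV := mul_pos I.vol_pos J.vol_pos
  have h1 : (∫⁻ x in rect I J, ‖b x - ⨍ y in rect I J, b y‖ₑ) / weightOf w (rect I J) ≤ ν := by
    refine le_trans ?_ hν
    refine le_iSup₂_of_le I hI (le_iSup₂_of_le J hJ le_rfl)
  have hi : IntegrableOn (fun x => b x - avg b I J) (rect I J) :=
    (hb I J).sub (integrableOn_const (volume_rect_lt_top I J).ne)
  rw [← avg_eq_setAverage, ENNReal.div_le_iff (hw.weightOf_ne_zero I J) (by
    rw [weightOf_rect_eq hw.rectIntegrable hw.ae_pos]; exact ENNReal.ofReal_ne_top),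
    weightOf_rect_eq hw.rectIntegrable hw.ae_pos, ← ofReal_integral_norm_eq_lintegral_enorm hi,
    ← ENNReal.ofReal_coe_nnreal, ← ENNReal.ofReal_mul ν.coe_nonneg, ENNReal.ofReal_le_ofReal_iff
      (mul_nonneg ν.coe_nonneg (mul_pos hV (hw.avg_pos I J)).le), ← vol_smul_avg, smul_eq_mul] at h1
  refine le_of_mul_le_mul_left ?_ hV
  linarith

end Oscillation

/-! ### Haar coefficients and martingale differences -/

section HaarCoeff

variable {n m : ℕ} {b : (Fin n → ℝ) × (Fin m → ℝ) → ℂ}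

/-- Cancellation allows any constant to be subtracted before Cauchy–Schwarz; the parent average is
used as the constant. -/
theorem norm_sum_haarSign_le {k : ℕ} {η : Fin k → Bool} (hη : η ∈ cancellative k)
    (f : (Fin k → Bool) → ℂ) (c : ℂ) :
    ‖∑ ε, haarSign η ε • f ε‖ ^ 2 ≤ Fintype.card (Fin k → Bool) * ∑ ε, ‖f ε - c‖ ^ 2 := by
  have h : ∑ ε, haarSign η ε • f ε = ∑ ε, haarSign η ε • (f ε - c) := by
    simp only [smul_sub, Finset.sum_sub_distrib, ← Finset.sum_smul, sum_haarSign hη, zero_smul,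
      sub_zero]
  rw [h]
  calc _ ≤ (∑ ε, ‖f ε - c‖) ^ 2 := by
        gcongr
        refine norm_sum_le_of_le _ fun ε _ => ?_
        rw [norm_smul, Real.norm_eq_abs, abs_haarSign, one_mul]
    _ ≤ _ := sq_sum_le_card_mul_sum_sq

/-- The pairing of `b` with `|I|⁻¹ 1_I ⊗ h_J^ζ`. -/
noncomputable def partialCoeff (b : (Fin n → ℝ) × (Fin m → ℝ) → ℂ) (J : Cube m)
    (ζ : Fin m → Bool) (I : Cube n) : ℂ :=
  (√J.vol / Fintype.card (Fin m → Bool)) • ∑ δ, haarSign ζ δ • avg b I (J.child δ)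

/-- The martingale property in `I` that lets the square function estimate apply to the partial
coefficients. -/
theorem sum_partialCoeff_child (hb : RectIntegrable b) (J : Cube m) (ζ : Fin m → Bool)
    (I : Cube n) :
    ∑ ε, partialCoeff b J ζ (I.child ε) =
      (Fintype.card (Fin n → Bool) : ℝ) • partialCoeff b J ζ I := by
  simp only [partialCoeff]
  rw [← Finset.smul_sum, Finset.sum_comm, smul_comm, Finset.smul_sum (s := Finset.univ)
    (r := (Fintype.card (Fin n → Bool) : ℝ))]
  simp only [← Finset.smul_sum, sum_avg_child_left hb, smul_comm _ (haarSign _ _)]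

theorem norm_partialCoeff_sq_le {ζ : Fin m → Bool} (hζ : ζ ∈ cancellative m) (J : Cube m)
    (I : Cube n) :
    ‖partialCoeff b J ζ I‖ ^ 2 ≤ J.vol / Fintype.card (Fin m → Bool) *
      ∑ δ, ‖avg b I (J.child δ) - avg b I J‖ ^ 2 := by
  have hV := J.vol_pos
  rw [partialCoeff, norm_smul, mul_pow, Real.norm_of_nonneg (by positivity), div_pow,
    Real.sq_sqrt hV.le]
  refine (mul_le_mul_of_nonneg_left (norm_sum_haarSign_le hζ _ (avg b I J))
    (by positivity)).trans (le_of_eq ?_)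
  field_simp

theorem haarCoeff_eq (hb : RectIntegrable b) (I : Cube n) (J : Cube m)
    (η : Fin n → Bool) (ζ : Fin m → Bool) :
    haarCoeff b I J η ζ = (√I.vol / Fintype.card (Fin n → Bool)) •
      ∑ ε, haarSign η ε • partialCoeff b J ζ (I.child ε) := by
  have hpt : ∀ x, b x * ((haar I η x.1 * haar J ζ x.2 : ℝ) : ℂ) =
      ∑ ε, ∑ δ, ((√I.vol)⁻¹ * (√J.vol)⁻¹ * haarSign η ε * haarSign ζ δ) •
        (rect (I.child ε) (J.child δ)).indicator b x := by
    intro x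
    rw [mul_comm, ← Complex.real_smul, haar_eq, haar_eq, mul_mul_mul_comm, Finset.sum_mul_sum,
      Finset.mul_sum, Finset.sum_smul]
    refine Finset.sum_congr rfl fun ε _ => ?_
    rw [Finset.mul_sum, Finset.sum_smul]
    refine Finset.sum_congr rfl fun δ _ => ?_
    by_cases h1 : x.1 ∈ (I.child ε).toSet <;> by_cases h2 : x.2 ∈ (J.child δ).toSet
    · rw [indicator_of_mem h1, indicator_of_mem h2, indicator_of_mem (show x ∈ rect _ _ from ⟨h1, h2⟩)]
      simp only [Pi.one_apply, mul_one]
      congr 1; ring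
    all_goals
      rw [indicator_of_notMem (s := rect _ _) (fun h => by first | exact h1 h.1 | exact h2 h.2)]
      simp [h1, h2]
  have hint : ∀ ε δ, Integrable ((rect (I.child ε) (J.child δ)).indicator b) := fun ε δ =>
    (integrable_indicator_iff (measurableSet_rect _ _)).2 (hb _ _)
  have hint' : ∀ (c : ℝ) ε δ,
      Integrable (fun x => c • (rect (I.child ε) (J.child δ)).indicator b x) :=
    fun c ε δ => (hint ε δ).smul c
  simp only [haarCoeff, hpt]
  rw [integral_finsetSum _ fun ε _ => integrable_finsetSum _ fun δ _ => hint' _ ε δ,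
    Finset.smul_sum]
  refine Finset.sum_congr rfl fun ε _ => ?_
  rw [integral_finsetSum _ fun δ _ => hint' _ ε δ, partialCoeff, Finset.smul_sum,
    Finset.smul_sum, Finset.smul_sum]
  refine Finset.sum_congr rfl fun δ _ => ?_
  rw [integral_smul, integral_indicator (measurableSet_rect _ _), ← vol_smul_avg]
  simp only [smul_smul]
  congr 1
  have hI := I.vol_pos
  have hJ := J.vol_pos
  have e1 : (I.child ε).vol = √I.vol * √I.vol / Fintype.card (Fin n → Bool) := by
    rw [Real.mul_self_sqrt hI.le, ← I.card_mul_vol_child ε]; field_simp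
  have e2 : (J.child δ).vol = √J.vol * √J.vol / Fintype.card (Fin m → Bool) := by
    rw [Real.mul_self_sqrt hJ.le, ← J.card_mul_vol_child δ]; field_simp
  rw [e1, e2]
  have := Real.sqrt_pos.2 hI
  have := Real.sqrt_pos.2 hJ
  field_simp

theorem norm_haarCoeff_sq_le (hb : RectIntegrable b) {η : Fin n → Bool}
    (hη : η ∈ cancellative n) (I : Cube n) (J : Cube m) (ζ : Fin m → Bool) :
    ‖haarCoeff b I J η ζ‖ ^ 2 ≤ I.vol / Fintype.card (Fin n → Bool) *
      ∑ ε, ‖partialCoeff b J ζ (I.child ε) - partialCoeff b J ζ I‖ ^ 2 := by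
  have hV := I.vol_pos
  rw [haarCoeff_eq hb, norm_smul, mul_pow, Real.norm_of_nonneg (by positivity), div_pow,
    Real.sq_sqrt hV.le]
  refine (mul_le_mul_of_nonneg_left (norm_sum_haarSign_le hη _ (partialCoeff b J ζ I))
    (by positivity)).trans (le_of_eq ?_)
  field_simp

end HaarCoeff

/-! ### Combining the two one-parameter estimates -/

section Assembly

variable {n m : ℕ} {D : Set (Cube n)} {D' : Set (Cube m)} {w : (Fin n → ℝ) × (Fin m → ℝ) → ℝ}
  {b : (Fin n → ℝ) × (Fin m → ℝ) → ℂ}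

/-- The weighted energy of the martingale difference of `b` in the second variable on `P × J`,
normalised in the first variable. -/
noncomputable def oscEnergy (w : (Fin n → ℝ) × (Fin m → ℝ) → ℝ)
    (b : (Fin n → ℝ) × (Fin m → ℝ) → ℂ) (P : Cube n) (J : Cube m) : ℝ :=
  J.vol * (∑ δ, ‖avg b P (J.child δ) - avg b P J‖ ^ 2) / avg w P J

theorem oscEnergy_nonneg (hw : IsA2Weight w) (P : Cube n) (J : Cube m) :
    0 ≤ oscEnergy w b P J := by
  have := J.vol_pos
  have := hw.avg_pos P J
  unfold oscEnergy
  have := Finset.sum_nonneg fun δ (_ : δ ∈ Finset.univ) =>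
    sq_nonneg ‖avg b P (J.child δ) - avg b P J‖
  positivity

/-- The constant of the square function estimate in the first variable. -/
noncomputable def squareConst (n : ℕ) (Q : ℝ) : ℝ :=
  (Fintype.card (Fin n → Bool) : ℝ) ^ 2 * (2 + 4 * (1 + Q + 2 * Q ^ 2) ^ 2)

/-- The constant of the packing estimate in the second variable. -/
noncomputable def packingConst (m : ℕ) (Q : ℝ) : ℝ :=
  128 * Q ^ 2 * (Fintype.card (Fin m → Bool) : ℝ) ^ 2

theorem squareConst_nonneg (n : ℕ) (Q : ℝ) : 0 ≤ squareConst n Q := by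
  unfold squareConst; positivity

theorem packingConst_nonneg (m : ℕ) (Q : ℝ) : 0 ≤ packingConst m Q := by
  unfold packingConst; positivity

theorem sum_sum_haarCoeff_le (hb : RectIntegrable b) (I : Cube n) (J : Cube m) :
    ∑ η ∈ cancellative n, ∑ ζ ∈ cancellative m, ‖haarCoeff b I J η ζ‖ ^ 2 ≤
      ∑ ζ ∈ cancellative m, I.vol *
        ∑ ε, ‖partialCoeff b J ζ (I.child ε) - partialCoeff b J ζ I‖ ^ 2 := by
  rw [Finset.sum_comm]
  refine Finset.sum_le_sum fun ζ _ => ?_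
  set S := ∑ ε, ‖partialCoeff b J ζ (I.child ε) - partialCoeff b J ζ I‖ ^ 2
  have hS : 0 ≤ S := Finset.sum_nonneg fun _ _ => sq_nonneg _
  have hV := I.vol_pos
  calc _ ≤ ∑ η ∈ cancellative n, I.vol / Fintype.card (Fin n → Bool) * S :=
        Finset.sum_le_sum fun η hη => norm_haarCoeff_sq_le hb hη I J ζ
    _ ≤ ∑ η : Fin n → Bool, I.vol / Fintype.card (Fin n → Bool) * S :=
        Finset.sum_le_sum_of_subset_of_nonneg (Finset.subset_univ _) fun _ _ _ => by positivity
    _ = _ := by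
        rw [Finset.sum_const, Finset.card_univ, nsmul_eq_mul]
        field_simp

theorem sum_norm_partialCoeff_sq_le (J : Cube m) (I : Cube n) :
    ∑ ζ ∈ cancellative m, ‖partialCoeff b J ζ I‖ ^ 2 ≤
      J.vol * ∑ δ, ‖avg b I (J.child δ) - avg b I J‖ ^ 2 := by
  set S := ∑ δ, ‖avg b I (J.child δ) - avg b I J‖ ^ 2
  have hS : 0 ≤ S := Finset.sum_nonneg fun _ _ => sq_nonneg _
  have hV := J.vol_pos
  calc _ ≤ ∑ ζ ∈ cancellative m, J.vol / Fintype.card (Fin m → Bool) * S :=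
        Finset.sum_le_sum fun ζ hζ => norm_partialCoeff_sq_le hζ J I
    _ ≤ ∑ ζ : Fin m → Bool, J.vol / Fintype.card (Fin m → Bool) * S :=
        Finset.sum_le_sum_of_subset_of_nonneg (Finset.subset_univ _) fun _ _ _ => by positivity
    _ = _ := by
        rw [Finset.sum_const, Finset.card_univ, nsmul_eq_mul]
        field_simp

/-- For a fixed cube `J`, the square function estimate in the first variable. -/
theorem exists_leaves_sum_le (hD : IsDyadicGrid D) (hn : 0 < n) (hw : IsA2Weight w)
    (hb : RectIntegrable b) (J : Cube m) {k : ℤ} (F : Finset (Cube n))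
    (hF : ∀ I ∈ F, I ∈ D ∧ (2 : ℝ) ^ k < I.side) :
    ∃ L : Finset (Cube n),
      (∀ P ∈ L, P ∈ D ∧ P.side = (2 : ℝ) ^ k ∧ ∃ I ∈ F, P.toSet ⊆ I.toSet) ∧
      ∑ I ∈ F, (∑ η ∈ cancellative n, ∑ ζ ∈ cancellative m, ‖haarCoeff b I J η ζ‖ ^ 2) /
          avg w I J ≤
        squareConst n (A2Const w).toReal * ∑ P ∈ L, P.vol * oscEnergy w b P J := by
  classical
  obtain ⟨M, hMF, hMd, hM⟩ := hD.exists_maximal hn F hF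
  -- Each maximal cube is subdivided down to the same side 2^k, whatever its own size.
  refine ⟨M.biUnion fun I => leaves (depth k I) I, fun P hP => ?_, ?_⟩
  · obtain ⟨I, hI, hPI⟩ := Finset.mem_biUnion.1 hP
    have hIF := hF I (hMF hI)
    refine ⟨hD.mem_of_mem_leaves hn hIF.1 hPI, ?_, I, hMF hI, subset_of_mem_leaves hPI⟩
    have h1 := side_of_mem_leaves hPI
    have h2 := hD.side_eq_depth hIF.1 hIF.2
    exact mul_left_cancel₀ (by positivity) (h1.trans h2)
  · set d : (Fin m → Bool) → Cube n → ℝ := fun ζ I =>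
      I.vol * (∑ ε, ‖partialCoeff b J ζ (I.child ε) - partialCoeff b J ζ I‖ ^ 2) / avg w I J
    have hd : ∀ ζ I, 0 ≤ d ζ I := fun ζ I => by
      have := I.vol_pos
      have := hw.avg_pos I J
      have := Finset.sum_nonneg fun ε (_ : ε ∈ Finset.univ) =>
        sq_nonneg ‖partialCoeff b J ζ (I.child ε) - partialCoeff b J ζ I‖
      positivity
    have hA : ∀ ζ I, treeSum Cube.child (d ζ) (depth k I) I ≤
        squareConst n (A2Const w).toReal * ∑ P ∈ leaves (depth k I) I,
          P.vol * (‖partialCoeff b J ζ P‖ ^ 2 / avg w P J) := by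
      intro ζ I
      rw [← leafSum_eq_sum_leaves]
      exact treeSum_sq_le_leafSum (s := fun I => avg (fun x => (w x)⁻¹) I J)
        (f := partialCoeff b J ζ) Cube.vol_pos
        Cube.card_mul_vol_child (fun I => hw.avg_pos I J) (fun I => hw.avg_inv_pos I J)
        (fun I => hw.one_le I J) (fun I => hw.avg_mul_le I J)
        (fun I => sum_avg_child_left hw.rectIntegrable I J)
        (fun I => sum_avg_child_left hw.rectIntegrable_inv I J)
        (fun I => sum_partialCoeff_child hb J ζ I) _ I
    calc _ ≤ ∑ I ∈ F, ∑ ζ ∈ cancellative m, d ζ I := by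
          refine Finset.sum_le_sum fun I _ => ?_
          have := hw.avg_pos I J
          rw [← Finset.sum_div]
          gcongr
          exact sum_sum_haarCoeff_le hb I J
      _ = ∑ ζ ∈ cancellative m, ∑ I ∈ F, d ζ I := Finset.sum_comm
      _ ≤ ∑ ζ ∈ cancellative m, ∑ I ∈ M, squareConst n (A2Const w).toReal *
          ∑ P ∈ leaves (depth k I) I, P.vol * (‖partialCoeff b J ζ P‖ ^ 2 / avg w P J) :=
        Finset.sum_le_sum fun ζ _ => (hM (d ζ) (hd ζ)).trans (Finset.sum_le_sum fun I _ => hA ζ I)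
      _ = squareConst n (A2Const w).toReal * ∑ P ∈ M.biUnion fun I => leaves (depth k I) I,
          P.vol * ((∑ ζ ∈ cancellative m, ‖partialCoeff b J ζ P‖ ^ 2) / avg w P J) := by
        simp only [← Finset.mul_sum]
        rw [Finset.sum_biUnion fun I hI I' hI' hne => disjoint_leaves (hMd hI hI' hne),
          Finset.sum_comm]
        congr 1
        refine Finset.sum_congr rfl fun I _ => ?_
        rw [Finset.sum_comm]
        refine Finset.sum_congr rfl fun P _ => ?_
        rw [Finset.sum_div, Finset.mul_sum]
      _ ≤ _ := by
        refine mul_le_mul_of_nonneg_left (Finset.sum_le_sum fun P _ => ?_) (squareConst_nonneg _ _)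
        have := P.vol_pos
        have := hw.avg_pos P J
        unfold oscEnergy
        gcongr
        exact sum_norm_partialCoeff_sq_le J P

/-- For a fixed cube `P`, the packing estimate in the second variable. -/
theorem exists_disjoint_sum_le (hD' : IsDyadicGrid D') (hm : 0 < m) (hw : IsA2Weight w)
    (hb : RectIntegrable b) {ν : ℝ≥0} (hν0 : 0 < ν) (hν : littleBMO D D' w b ≤ ν)
    {P : Cube n} (hP : P ∈ D) {k : ℤ} (G : Finset (Cube m))
    (hG : ∀ J ∈ G, J ∈ D' ∧ (2 : ℝ) ^ k < J.side) :
    ∃ M ⊆ G, (M : Set (Cube m)).PairwiseDisjoint Cube.toSet ∧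
      ∑ J ∈ G, oscEnergy w b P J ≤
        packingConst m (A2Const w).toReal * (ν : ℝ) ^ 2 * ∑ J ∈ M, J.vol * avg w P J := by
  obtain ⟨M, hMG, hMd, hM⟩ := hD'.exists_maximal hm G hG
  refine ⟨M, hMG, hMd, (hM _ (oscEnergy_nonneg hw P)).trans ?_⟩
  rw [Finset.mul_sum]
  refine Finset.sum_le_sum fun J hJ => ?_
  exact treeSum_osc_le (p := (· ∈ D')) (fun K hK δ => hD'.child_mem hm hK δ)
    (s := fun J => avg (fun x => (w x)⁻¹) P J) (u := avg w P)
    (β := avg b P) (a := fun K J => avg (fun x => ‖b x - avg b P K‖) P J)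
    (ν := ν) (by exact_mod_cast hν0) Fintype.card_pos Cube.vol_pos
    Cube.card_mul_vol_child (fun J => hw.avg_pos P J) (fun J => hw.avg_inv_pos P J)
    (fun J => hw.one_le P J) (fun J => hw.avg_mul_le P J)
    (fun J => sum_avg_child_right hw.rectIntegrable P J)
    (fun J => sum_avg_child_right hw.rectIntegrable_inv P J)
    (fun K J => sum_avg_child_right (hb.norm_sub_const _) P J)
    (fun J => sum_avg_child_right hb P J)
    (fun K J => norm_avg_sub_le hb _ P J)
    (fun K hK => avg_osc_le hw hb hν hP hK) _ J (hG J (hMG hJ)).1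

theorem exists_zpow_lt_side (S : Finset (Cube n × Cube m)) :
    ∃ k : ℤ, ∀ R ∈ S, (2 : ℝ) ^ k < R.1.side ∧ (2 : ℝ) ^ k < R.2.side := by
  classical
  obtain ⟨k, hk⟩ :=
    (S.image fun R => min (Int.log 2 R.1.side) (Int.log 2 R.2.side)).bddBelow
  -- The shift to k - 1 makes the inequality strict, so every cube of the family is split at least
  -- once.
  have key : ∀ x : ℝ, 0 < x → k ≤ Int.log 2 x → (2 : ℝ) ^ (k - 1) < x := fun x hx hkx =>
    calc (2 : ℝ) ^ (k - 1) < 2 ^ (Int.log 2 x) :=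
          zpow_lt_zpow_right₀ one_lt_two (by omega)
      _ ≤ x := by exact_mod_cast Int.zpow_log_le_self (R := ℝ) one_lt_two hx
  refine ⟨k - 1, fun R hR => ?_⟩
  have := le_min_iff.1 (hk (Finset.mem_coe.2 (Finset.mem_image_of_mem _ hR)))
  exact ⟨key _ R.1.side_pos this.1, key _ R.2.side_pos this.2⟩

/-- The order of summation is exchanged between the two estimates: `I` is summed for fixed `J`, then
`J` for fixed `P`. The common scale of the `P` is what makes the final rectangles disjoint. -/
theorem sum_haar_energy_le (hn : 0 < n) (hm : 0 < m) (hD : IsDyadicGrid D)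
    (hD' : IsDyadicGrid D') (hw : IsA2Weight w) (hb : RectIntegrable b) {ν : ℝ≥0} (hν0 : 0 < ν)
    (hν : littleBMO D D' w b ≤ ν) (Ω : Set ((Fin n → ℝ) × (Fin m → ℝ)))
    (S : Finset (Cube n × Cube m)) (hS : ∀ R ∈ S, R.1 ∈ D ∧ R.2 ∈ D' ∧ rect R.1 R.2 ⊆ Ω) :
    ENNReal.ofReal (∑ R ∈ S,
      (∑ η ∈ cancellative n, ∑ ζ ∈ cancellative m, ‖haarCoeff b R.1 R.2 η ζ‖ ^ 2) /
        avg w R.1 R.2) ≤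
      ENNReal.ofReal (squareConst n (A2Const w).toReal * packingConst m (A2Const w).toReal *
        (ν : ℝ) ^ 2) * weightOf w Ω := by
  classical
  obtain ⟨k, hk⟩ := exists_zpow_lt_side S
  set c₁ := squareConst n (A2Const w).toReal
  set c₂ := packingConst m (A2Const w).toReal
  set F : Cube m → Finset (Cube n) := fun J => (S.filter fun R => R.2 = J).image Prod.fst with hF
  set G := S.image Prod.snd with hG
  have hmemF : ∀ {I J}, I ∈ F J ↔ (I, J) ∈ S := by
    intro I J; simp [hF]
  have hFk : ∀ J, ∀ I ∈ F J, I ∈ D ∧ (2 : ℝ) ^ k < I.side := fun J I hI =>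
    ⟨(hS _ (hmemF.1 hI)).1, (hk _ (hmemF.1 hI)).1⟩
  have hGk : ∀ J ∈ G, J ∈ D' ∧ (2 : ℝ) ^ k < J.side := by
    intro J hJ
    obtain ⟨R, hR, rfl⟩ := Finset.mem_image.1 hJ
    exact ⟨(hS R hR).2.1, (hk R hR).2⟩
  choose L hL hLsum using fun J => exists_leaves_sum_le hD hn hw hb J (F J) (hFk J)
  set P := G.biUnion L with hP
  have hPD : ∀ p ∈ P, p ∈ D ∧ p.side = (2 : ℝ) ^ k := by
    intro p hp
    obtain ⟨J, -, hpJ⟩ := Finset.mem_biUnion.1 hp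
    exact ⟨(hL J p hpJ).1, (hL J p hpJ).2.1⟩
  -- The packing estimate is run only over those `J` for which `p` is a leaf; this later places p ×
  -- J inside Ω. Outside `P` the empty family serves as a default.
  have hex : ∀ p, ∃ M : Finset (Cube m), p ∈ P →
      (M ⊆ G.filter fun J => p ∈ L J) ∧ (M : Set (Cube m)).PairwiseDisjoint Cube.toSet ∧
      ∑ J ∈ G.filter fun J => p ∈ L J, oscEnergy w b p J ≤
        c₂ * (ν : ℝ) ^ 2 * ∑ J ∈ M, J.vol * avg w p J := by
    intro p
    by_cases hp : p ∈ P
    · obtain ⟨M, h1, h2, h3⟩ := exists_disjoint_sum_le hD' hm hw hb hν0 hν (hPD p hp).1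
        (G.filter fun J => p ∈ L J) fun J hJ => hGk J (Finset.mem_filter.1 hJ).1
      exact ⟨M, fun _ => ⟨h1, h2, h3⟩⟩
    · exact ⟨∅, fun h => absurd h hp⟩
  choose M hM using hex
  have hreal : ∑ R ∈ S,
      (∑ η ∈ cancellative n, ∑ ζ ∈ cancellative m, ‖haarCoeff b R.1 R.2 η ζ‖ ^ 2) /
        avg w R.1 R.2 ≤
      c₁ * c₂ * (ν : ℝ) ^ 2 * ∑ x ∈ P.sigma M, x.1.vol * x.2.vol * avg w x.1 x.2 := by
    rw [Finset.sum_finset_product_right S G F (fun R => by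
      constructor
      · exact fun h => ⟨Finset.mem_image_of_mem _ h, hmemF.2 h⟩
      · exact fun h => hmemF.1 h.2)]
    calc _ ≤ ∑ J ∈ G, c₁ * ∑ p ∈ L J, p.vol * oscEnergy w b p J :=
          Finset.sum_le_sum fun J _ => hLsum J
      _ = c₁ * ∑ p ∈ P, p.vol * ∑ J ∈ G.filter fun J => p ∈ L J, oscEnergy w b p J := by
          rw [← Finset.mul_sum]
          congr 1
          rw [Finset.sum_comm' (t' := P) (s' := fun p => G.filter fun J => p ∈ L J)]
          · simp only [Finset.mul_sum]
          · intro J p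
            simp only [hP, Finset.mem_filter, Finset.mem_biUnion]
            exact ⟨fun h => ⟨h, J, h⟩, fun h => h.1⟩
      _ ≤ c₁ * ∑ p ∈ P, p.vol * (c₂ * (ν : ℝ) ^ 2 * ∑ J ∈ M p, J.vol * avg w p J) := by
          refine mul_le_mul_of_nonneg_left (Finset.sum_le_sum fun p hp => ?_)
            (squareConst_nonneg _ _)
          exact mul_le_mul_of_nonneg_left (hM p hp).2.2 p.vol_pos.le
      _ = _ := by
          rw [Finset.sum_sigma]
          simp only [Finset.mul_sum]
          refine Finset.sum_congr rfl fun p _ => Finset.sum_congr rfl fun J _ => ?_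
          ring
  have hdisj : (↑(P.sigma M) : Set (Σ _ : Cube n, Cube m)).PairwiseDisjoint
      fun x => rect x.1 x.2 := by
    rintro ⟨p, J⟩ hx ⟨p', J'⟩ hx' hne
    rw [Finset.mem_coe, Finset.mem_sigma] at hx hx'
    dsimp only at hx hx'
    by_cases hpp : p = p'
    · subst hpp
      have hJJ : J ≠ J' := fun h => hne (by rw [h])
      exact Disjoint.set_prod_right ((hM p hx.1).2.1 hx.2 hx'.2 hJJ) _ _
    · refine Disjoint.set_prod_left (Set.disjoint_left.2 fun y hy hy' => hpp ?_) _ _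
      exact hD.eq_of_mem (hPD p hx.1).1 (hPD p' hx'.1).1
        ((hPD p hx.1).2.trans (hPD p' hx'.1).2.symm) hy hy'
  have hsub : (⋃ (x : Σ _ : Cube n, Cube m) (_ : x ∈ P.sigma M), rect x.1 x.2) ⊆ Ω := by
    refine iUnion₂_subset fun x hx => ?_
    rw [Finset.mem_sigma] at hx
    have hJ := Finset.mem_filter.1 ((hM _ hx.1).1 hx.2)
    obtain ⟨I, hI, hsubI⟩ := (hL _ _ hJ.2).2.2
    exact (prod_mono_left hsubI).trans (hS _ (hmemF.1 hI)).2.2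
  have hc : 0 ≤ c₁ * c₂ * (ν : ℝ) ^ 2 :=
    mul_nonneg (mul_nonneg (squareConst_nonneg _ _) (packingConst_nonneg _ _)) (sq_nonneg _)
  refine (ENNReal.ofReal_le_ofReal hreal).trans ?_
  rw [ENNReal.ofReal_mul hc, ENNReal.ofReal_sum_of_nonneg fun x _ =>
    (mul_pos (mul_pos x.1.vol_pos x.2.vol_pos) (hw.avg_pos _ _)).le]
  gcongr
  simp only [← weightOf_rect_eq hw.rectIntegrable hw.ae_pos]
  calc _ = weightOf w (⋃ (x : Σ _ : Cube n, Cube m) (_ : x ∈ P.sigma M), rect x.1 x.2) :=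
        (lintegral_biUnion_finset hdisj (fun x _ => measurableSet_rect _ _) _).symm
    _ ≤ _ := lintegral_mono_set hsub

theorem cancellative_zero : cancellative 0 = ∅ := by
  refine Finset.filter_eq_empty_iff.2 fun η _ h => h (Subsingleton.elim _ _)

theorem prodBMO_eq_zero (h : n = 0 ∨ m = 0) (D : Set (Cube n)) (D' : Set (Cube m))
    (w : (Fin n → ℝ) × (Fin m → ℝ) → ℝ) (b : (Fin n → ℝ) × (Fin m → ℝ) → ℂ) :
    prodBMO D D' w b = 0 := by
  rcases h with rfl | rfl <;> simp [prodBMO, cancellative_zero]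

theorem enorm_energy_eq (hw : IsA2Weight w) (I : Cube n) (J : Cube m) :
    (∑ η ∈ cancellative n, ∑ ζ ∈ cancellative m, ‖haarCoeff b I J η ζ‖ₑ ^ 2) / weightAvg w I J =
      ENNReal.ofReal ((∑ η ∈ cancellative n, ∑ ζ ∈ cancellative m,
        ‖haarCoeff b I J η ζ‖ ^ 2) / avg w I J) := by
  rw [ENNReal.ofReal_div_of_pos (hw.avg_pos I J), weightAvg_eq hw.rectIntegrable hw.ae_pos,
    ENNReal.ofReal_sum_of_nonneg fun _ _ => Finset.sum_nonneg fun _ _ => sq_nonneg _]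
  congr 1
  refine Finset.sum_congr rfl fun η _ => ?_
  rw [ENNReal.ofReal_sum_of_nonneg fun _ _ => sq_nonneg _]
  refine Finset.sum_congr rfl fun ζ _ => ?_
  rw [ENNReal.ofReal_pow (norm_nonneg _), ofReal_norm]

theorem prodBMO_le (hn : 0 < n) (hm : 0 < m) (hD : IsDyadicGrid D)
    (hD' : IsDyadicGrid D') (hw : IsA2Weight w) (hb : RectIntegrable b) {ν : ℝ≥0} (hν0 : 0 < ν)
    (hν : littleBMO D D' w b ≤ ν) {C : ℝ≥0} (hC : squareConst n (A2Const w).toReal *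
      packingConst m (A2Const w).toReal ≤ (C : ℝ) ^ 2) :
    prodBMO D D' w b ≤ C * ν := by
  refine iSup₂_le fun Ω _ => ?_
  have h2 : ((C : ℝ≥0∞) * ν) = (((C : ℝ≥0∞) * ν) ^ 2) ^ (1 / 2 : ℝ) := by
    rw [← ENNReal.rpow_natCast, ← ENNReal.rpow_mul]; simp
  rw [h2]
  refine ENNReal.rpow_le_rpow (ENNReal.div_le_of_le_mul ?_) (by norm_num)
  -- Reduction to finite families, where a smallest scale exists.
  rw [ENNReal.tsum_eq_iSup_sum]
  refine iSup_le fun S => ?_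
  simp only [enorm_energy_eq hw]
  have hnn : ∀ I J, 0 ≤ (∑ η ∈ cancellative n, ∑ ζ ∈ cancellative m,
      ‖haarCoeff b I J η ζ‖ ^ 2) / avg w I J := fun I J =>
    div_nonneg (Finset.sum_nonneg fun _ _ => Finset.sum_nonneg fun _ _ => sq_nonneg _)
      (hw.avg_pos I J).le
  rw [← ENNReal.ofReal_sum_of_nonneg fun _ _ => hnn _ _]
  have h := sum_haar_energy_le hn hm hD hD' hw hb hν0 hν Ω (S.map (Function.Embedding.subtype _))
    (fun R hR => by
      obtain ⟨R', -, rfl⟩ := Finset.mem_map.1 hR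
      exact R'.2)
  rw [Finset.sum_map] at h
  refine h.trans ?_
  gcongr
  refine (ENNReal.ofReal_le_ofReal (mul_le_mul_of_nonneg_right hC (sq_nonneg _))).trans
    (le_of_eq ?_)
  rw [← mul_pow, ← NNReal.coe_mul, ← NNReal.coe_pow, ENNReal.ofReal_coe_nnreal]
  push_cast; rfl

end Assembly

end Biparam

theorem mainTheorem5 (n m : ℕ) :
    ∃ C : ℝ≥0 → ℝ≥0, Monotone C ∧
      ∀ (D : Set (Biparam.Cube n)) (D' : Set (Biparam.Cube m)),
        Biparam.IsDyadicGrid D → Biparam.IsDyadicGrid D' →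
      ∀ w : (Fin n → ℝ) × (Fin m → ℝ) → ℝ, Biparam.IsA2Weight w →
      ∀ b : (Fin n → ℝ) × (Fin m → ℝ) → ℂ, LocallyIntegrable b volume →
        Biparam.prodBMO D D' w b ≤
          (C (Biparam.A2Const w).toNNReal : ℝ≥0∞) * Biparam.littleBMO D D' w b := by
  -- Adding 1 avoids a square root, since x ≤ (1 + x)² for x ≥ 0, and keeps the constant nonzero for
  -- the divisions below.
  refine ⟨fun Q => 1 + (Fintype.card (Fin n → Bool) : ℝ≥0) ^ 2 *
    (2 + 4 * (1 + Q + 2 * Q ^ 2) ^ 2) * (128 * Q ^ 2 * (Fintype.card (Fin m → Bool) : ℝ≥0) ^ 2),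
    fun Q Q' h => by dsimp only; gcongr, fun D D' hD hD' w hw b hb => ?_⟩
  dsimp only
  set C : ℝ≥0 := 1 + (Fintype.card (Fin n → Bool) : ℝ≥0) ^ 2 *
    (2 + 4 * (1 + (Biparam.A2Const w).toNNReal + 2 * (Biparam.A2Const w).toNNReal ^ 2) ^ 2) *
    (128 * (Biparam.A2Const w).toNNReal ^ 2 * (Fintype.card (Fin m → Bool) : ℝ≥0) ^ 2) with hC
  rcases Nat.eq_zero_or_pos n with hn | hn
  · rw [Biparam.prodBMO_eq_zero (Or.inl hn)]; exact bot_le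
  rcases Nat.eq_zero_or_pos m with hm | hm
  · rw [Biparam.prodBMO_eq_zero (Or.inr hm)]; exact bot_le
  have hCle : Biparam.squareConst n (Biparam.A2Const w).toReal *
      Biparam.packingConst m (Biparam.A2Const w).toReal ≤ (C : ℝ) ^ 2 := by
    have h0 := mul_nonneg (Biparam.squareConst_nonneg n (Biparam.A2Const w).toReal)
      (Biparam.packingConst_nonneg m (Biparam.A2Const w).toReal)
    have e : (C : ℝ) = 1 + Biparam.squareConst n (Biparam.A2Const w).toReal *
        Biparam.packingConst m (Biparam.A2Const w).toReal := by
      rw [hC, Biparam.squareConst, Biparam.packingConst, ← ENNReal.coe_toNNReal_eq_toReal]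
      push_cast; rfl
    rw [e]; nlinarith
  have hC0 : (C : ℝ≥0∞) ≠ 0 := by
    rw [ENNReal.coe_ne_zero, hC]; positivity
  rw [mul_comm, ← ENNReal.div_le_iff hC0 ENNReal.coe_ne_top]
  -- The packing estimate needs a positive bound, so the little BMO norm, possibly zero, is
  -- approached from above.
  refine le_of_forall_gt_imp_ge_of_dense fun ν hν => ?_
  rw [ENNReal.div_le_iff hC0 ENNReal.coe_ne_top]
  rcases eq_or_ne ν ∞ with rfl | hνt
  · rw [ENNReal.top_mul hC0]; exact le_top
  lift ν to ℝ≥0 using hνt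
  rw [mul_comm]
  exact Biparam.prodBMO_le hn hm hD hD' hw (Biparam.rectIntegrable_of_locallyIntegrable hb)
    (ENNReal.coe_pos.1 (bot_le.trans_lt hν)) hν.le hCle
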